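/- Let $d\ge 1$ and let $\mu=\mu_{eq}^{\otimes d}$ be the product arcsine measure on $[-1,1]^d$, where $\mu_{eq}(dx)=\frac{1}{\pi\sqrt{1-x^2}}\mathbf 1_{[-1,1]}(x)\,dx$. Order $\mathbb N^d$ ($\mathbb N=\{0,1,2,\dots\}$) by the graded lexicographic order: $\alpha<\beta$ if $\max_j\alpha_j<\max_j\beta_j$, or if $\max_j\alpha_j=\max_j\beta_j$ and there is $j$ with $\alpha_i=\beta_i$ for all $i<j$ and $\alpha_j<\beta_j$. Let $\mathfrak b:\mathbb N\to\mathbb N^d$ be the increasing bijection for this order, let $(\phi_n)_{n\ge0}$ be the polynomials obtained by applying the Gram--Schmidt orthonormalization in $L^2(\mu)$ to the monomials $x^{\mathfrak b(0)},x^{\mathfrak b(1)},\dots$, and put $K_N(x,y)=\sum_{n=0}^{N-1}\phi_n(x)\phi_n(y)$. The multivariate OP Ensemble of $\mu$ with $N$ points is the random vector $(\mathbf x_1,\dots,\mathbf x_N)$ with joint law $$\frac1{N!}\det\big[K_N(x_i,x_j)\big]_{i,j=1}^N\,\prod_{i=1}^N\mu(dx_i).$$ Let $T_0=1$ and, for $k\ge1$,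 let $T_k$ be the polynomial with $T_k(\cos\theta)=\sqrt2\cos(k\theta)$; for $\boldsymbol k=(k_1,\dots,k_d)\in\mathbb N^d$ let $T_{\boldsymbol k}(x)=T_{k_1}(x_1)\cdots T_{k_d}(x_d)$. Then, for all $N$, the displayed measure is a probability measure and the linear statistics $\sum_{i=1}^N T_{\boldsymbol k}(\mathbf x_i)$ are square integrable, and, for all multi-indices $\boldsymbol k,\boldsymbol\ell\in\mathbb N^d$, $$\lim_{N\to\infty}\frac1{N^{1-1/d}}\,\mathrm{Cov}\Big[\sum_{i=1}^N T_{\boldsymbol k}(\mathbf x_i),\ \sum_{i=1}^N T_{\boldsymbol\ell}(\mathbf x_i)\Big]=\begin{cases}\tfrac12(k_1+\cdots+k_d)&\text{if }\boldsymbol k=\boldsymbol\ell,\\ 0&\text{if }\boldsymbol k\ne\boldsymbol\ell.\end{cases}$$ -/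

import Mathlib

open MeasureTheory ProbabilityTheory Filter Topology
open scoped BigOperators Nat

noncomputable section

namespace OPEnsemble

/-- The equilibrium (arcsine) measure `dx / (π √(1 - x²))` of the interval `[-1, 1]`. -/
def muEq : Measure ℝ :=
  (volume : Measure ℝ).withDensity fun x =>
    ENNReal.ofReal ((Set.Icc (-1 : ℝ) 1).indicator (fun x => 1 / (Real.pi * √(1 - x ^ 2))) x)

/-- The product measure on `ℝ^d` whose `d` factors are all equal to `muEq`. -/
def muEqProd (d : ℕ) : Measure (Fin d → ℝ) := Measure.pi fun _ => muEq

/-- The Chebyshev polynomials of the first kind, normalized in `L²(muEq)`: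
`T_0 = 1` and `T_k (cos θ) = √2 cos (k θ)` for `k ≥ 1`. -/
def chebT (k : ℕ) (x : ℝ) : ℝ :=
  if k = 0 then 1 else √2 * (Polynomial.Chebyshev.T ℝ (k : ℤ)).eval x

/-- The multivariate Chebyshev polynomials `T_k (x) = ∏ j, T_{k_j} (x_j)`. -/
def multiChebT {d : ℕ} (k : Fin d → ℕ) (x : Fin d → ℝ) : ℝ := ∏ j, chebT (k j) (x j)

/-- A multi-index is compared in the graded lexicographic order through its maximal entry first
and then lexicographically: `α < β` means `gradedLexKey α < gradedLexKey β`. -/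
def gradedLexKey {d : ℕ} (α : Fin d → ℕ) : ℕ ×ₗ Lex (Fin d → ℕ) :=
  toLex (Finset.univ.sup α, toLex α)

theorem exists_notMem_range {d : ℕ} [NeZero d] {n : ℕ} (g : Fin n → Fin d → ℕ) :
    {α : Fin d → ℕ | ∀ k, g k ≠ α}.Nonempty := by
  obtain ⟨α, hα⟩ := (Set.finite_range g).infinite_compl.nonempty
  exact ⟨α, fun k hk => hα ⟨k, hk⟩⟩

/-- The increasing enumeration of `ℕ^d` for the graded lexicographic order: `gradedLexEnum d n` is
the smallest multi-index that differs from `gradedLexEnum d 0, …, gradedLexEnum d (n - 1)`. -/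
def gradedLexEnum (d : ℕ) [NeZero d] (n : ℕ) : Fin d → ℕ :=
  Function.argminOn gradedLexKey {α : Fin d → ℕ | ∀ k : Fin n, gradedLexEnum d k ≠ α}
    (exists_notMem_range fun k : Fin n => gradedLexEnum d k)
termination_by n
decreasing_by all_goals exact k.2

/-- The monomial function `x ↦ ∏ j, x_j ^ α_j`. -/
def monomialFun {d : ℕ} (α : Fin d → ℕ) (x : Fin d → ℝ) : ℝ := ∏ j, x j ^ α j

/-- The multivariate orthonormal polynomials of `μ`: the Gram-Schmidt algorithm in `L²(μ)`
applied to the monomials, taken in the graded lexicographic order. -/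
def orthoPoly {d : ℕ} [NeZero d] (μ : Measure (Fin d → ℝ)) (n : ℕ) : (Fin d → ℝ) → ℝ :=
  let r : (Fin d → ℝ) → ℝ := fun x =>
    monomialFun (gradedLexEnum d n) x -
      ∑ k : Fin n, (∫ y, monomialFun (gradedLexEnum d n) y * orthoPoly μ k y ∂μ) * orthoPoly μ k x
  fun x => r x / √(∫ y, r y ^ 2 ∂μ)
termination_by n
decreasing_by all_goals exact k.2

/-- The `N`-th Christoffel-Darboux kernel `K_N (x, y) = ∑_{k < N} φ_k (x) φ_k (y)`. -/
def cdKernel {d : ℕ} [NeZero d] (μ : Measure (Fin d → ℝ)) (N : ℕ) (x y : Fin d → ℝ) : ℝ :=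
  ∑ k ∈ Finset.range N, orthoPoly μ k x * orthoPoly μ k y

/-- The joint law of the `N` points of the multivariate OP Ensemble of `μ`:
`(1 / N!) det [K_N (x_i, x_l)] ∏ μ(dx_i)`. -/
def opEnsemble {d : ℕ} [NeZero d] (μ : Measure (Fin d → ℝ)) (N : ℕ) :
    Measure (Fin N → Fin d → ℝ) :=
  (Measure.pi fun _ : Fin N => μ).withDensity fun x =>
    ENNReal.ofReal ((1 / (N ! : ℝ)) * (Matrix.of fun i l => cdKernel μ N (x i) (x l)).det)

/-- The linear statistic `∑ i, f (x_i)`. -/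
def linStat {d : ℕ} (f : (Fin d → ℝ) → ℝ) (N : ℕ) (x : Fin N → Fin d → ℝ) : ℝ := ∑ i, f (x i)

end OPEnsemble

end

/-!
The orthonormal polynomials of the product arcsine measure are the products of Chebyshev
polynomials, taken in the graded lexicographic order (`orthoPoly_muEqProd`): the expansion of
`x ^ α` in Chebyshev polynomials has a positive leading coefficient and involves only indices below
`α` entrywise. The ensemble is therefore a determinantal projection ensemble (`projEnsemble`), and
for such an ensemble `Cov = ∑_{n < N} ⟨f g φ_n, φ_n⟩ - ∑_{n, m < N} ⟨f φ_n, φ_m⟩ ⟨g φ_m, φ_n⟩`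
(`covariance_linearStatistic`). With `Γ` the set of the first `N` multi-indices and `c` the
coefficients of the multiplication by a Chebyshev polynomial, this is
`∑_{α ∈ Γ, β ∉ Γ} c_k(α, β) c_l(α, β)` (`covariance_linStat_multiChebT`).

Away from the coordinate hyperplanes, `c_k(α, β) c_l(α, β)` vanishes for `k ≠ l`, while
`c_k(α, β) ^ 2` is the transition probability of a walk whose coordinates make independent
steps `± k_j` (`linCoef_mul_linCoef`). So for `k = l` the covariance counts the points `α` of `Γ`
near its boundary, each with the probability that the walk leaves `Γ` from there.

Let `t` be the first multi-index not in `Γ` and `M` its maximal entry, so that `Γ` lies between the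
cubes `[0, M)^d` and `[0, M]^d` and `M` is asymptotic to `N ^ (1 / d)`. Call a coordinate of `α`
special when it is within bounded distance of `0`, of `M`, or of the same coordinate of `t`. The
points with two special coordinates number `O(M ^ (d - 2))` (`card_exceptionalSet_mul_le`) and may
be ignored. If only the `j`-th coordinate is special, the lines in direction `j` through `α` and
through its neighbours leave `Γ` at the same height, `M` or `M + 1`: the lexicographic comparison
with `t` is decided by a coordinate that no bounded shift can move across `t` (`exitHeight_congr`).
Hence only the `j`-th step matters, it leads outside with probability `1 / 2`, and it does so exactly
for `k_j` points on each line (`card_face`). There are about `M ^ (d - 1)` lines in each of the `d`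
directions, which gives the limit `(k_1 + ⋯ + k_d) / 2`.
-/
noncomputable section

namespace OPEnsemble

/-! ### The arcsine measure and the Chebyshev polynomials in one variable -/

section

open Polynomial.Chebyshev in
theorem muEq_eq_smul_measureT : muEq = ENNReal.ofReal (1 / Real.pi) • measureT := by
  rw [muEq, measureT, restrict_withDensity measurableSet_Ioc, ← withDensity_indicator measurableSet_Ioc,
    ← withDensity_smul' _ _ ENNReal.ofReal_ne_top]
  congr 1
  ext x
  simp only [Pi.smul_apply, smul_eq_mul]
  by_cases hx : x ∈ Set.Ioc (-1 : ℝ) 1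
  · rw [Set.indicator_of_mem (Set.Ioc_subset_Icc_self hx), Set.indicator_of_mem hx]
    have : (ENNReal.ofNNReal (.mk (√(1 - x ^ 2)⁻¹) (by positivity))) =
        ENNReal.ofReal (√(1 - x ^ 2))⁻¹ := by
      rw [ENNReal.ofReal, Real.toNNReal_of_nonneg (by positivity)]
      congr 2
      exact Real.sqrt_inv _
    rw [this, ← ENNReal.ofReal_mul (by positivity)]
    congr 1
    rw [one_div, one_div, mul_inv]
  · rw [Set.indicator_of_notMem hx, mul_zero]
    by_cases h1 : x ∈ Set.Icc (-1 : ℝ) 1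
    -- At the end point `-1` the density is `1 / 0 = 0`.
    · have : x = -1 := by
        simp only [Set.mem_Ioc, not_and, not_le, Set.mem_Icc] at hx h1
        by_contra h
        have := hx (lt_of_le_of_ne h1.1 (Ne.symm h))
        linarith [h1.2]
      subst this
      simp
    · rw [Set.indicator_of_notMem h1, ENNReal.ofReal_zero]

theorem integral_muEq (f : ℝ → ℝ) :
    ∫ x, f x ∂muEq = 1 / Real.pi * ∫ x, f x ∂Polynomial.Chebyshev.measureT := by
  rw [muEq_eq_smul_measureT, integral_smul_measure, ENNReal.toReal_ofReal (by positivity),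
    smul_eq_mul]

theorem integrable_muEq {f : ℝ → ℝ} (hf : Continuous f) : Integrable f muEq := by
  rw [muEq_eq_smul_measureT]
  exact (Polynomial.Chebyshev.integrable_measureT hf.continuousOn).smul_measure
    ENNReal.ofReal_ne_top

instance isProbabilityMeasure_muEq : IsProbabilityMeasure muEq := by
  have hfin : Integrable (fun _ : ℝ => (1 : ℝ)) muEq := integrable_muEq continuous_const
  have h1 : ∫ _, (1 : ℝ) ∂muEq = 1 := by
    rw [integral_muEq]
    have := Polynomial.Chebyshev.integral_eval_T_real_measureT_zero
    simp only [Polynomial.Chebyshev.T_zero, Polynomial.eval_one] at this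
    rw [this]
    field_simp
  have : IsFiniteMeasure muEq := by
    rw [integrable_const_iff] at hfin
    simpa using hfin
  refine ⟨?_⟩
  rw [integral_const, smul_eq_mul, mul_one, measureReal_def] at h1
  rwa [ENNReal.toReal_eq_one_iff] at h1

/-- The factor that normalizes the `n`-th Chebyshev polynomial in `L²(muEq)`. -/
def chebNorm (n : ℕ) : ℝ := if n = 0 then 1 else √2

theorem chebT_eq (n : ℕ) (x : ℝ) :
    chebT n x = chebNorm n * (Polynomial.Chebyshev.T ℝ (n : ℤ)).eval x := by
  unfold chebT chebNorm
  split_ifs with h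
  · simp [h]
  · rfl

theorem one_le_chebNorm (n : ℕ) : 1 ≤ chebNorm n := by
  unfold chebNorm
  split_ifs
  · exact le_rfl
  · exact Real.one_le_sqrt.mpr (by norm_num)

theorem chebNorm_pos (n : ℕ) : 0 < chebNorm n := one_pos.trans_le (one_le_chebNorm n)

theorem chebNorm_sq {n : ℕ} (hn : n ≠ 0) : chebNorm n ^ 2 = 2 := by
  simp [chebNorm, hn]

theorem chebNorm_sq_le (n : ℕ) : chebNorm n ^ 2 ≤ 2 := by
  unfold chebNorm
  split_ifs <;> norm_num

@[fun_prop]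
theorem continuous_chebT (n : ℕ) : Continuous (chebT n) := by
  rw [show chebT n = fun x => chebNorm n * (Polynomial.Chebyshev.T ℝ (n : ℤ)).eval x from
    funext (chebT_eq n)]
  fun_prop

theorem integral_chebT_mul_chebT (n m : ℕ) :
    ∫ x, chebT n x * chebT m x ∂muEq = if n = m then 1 else 0 := by
  have h : ∀ x, chebT n x * chebT m x = chebNorm n * chebNorm m *
      ((Polynomial.Chebyshev.T ℝ (n : ℤ)).eval x * (Polynomial.Chebyshev.T ℝ (m : ℤ)).eval x) := by
    intro x
    rw [chebT_eq, chebT_eq]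
    ring
  simp_rw [h]
  rw [integral_const_mul, integral_muEq]
  split_ifs with hnm
  · subst hnm
    rcases eq_or_ne n 0 with rfl | hn
    · have := Polynomial.Chebyshev.integral_eval_T_real_mul_self_measureT_zero
      rw [Nat.cast_zero, this, chebNorm, if_pos rfl]
      field_simp
    · rw [Polynomial.Chebyshev.integral_T_real_mul_self_measureT_of_ne_zero hn, ← sq,
        chebNorm_sq hn]
      field_simp
  · rw [Polynomial.Chebyshev.integral_eval_T_real_mul_eval_T_real_measureT_of_ne hnm]
    ring

/-- The coefficient of `chebT b` in the expansion of `chebT k * chebT a`. The two indices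
`k + a` and `|k - a|` coincide when `k = 0` or `a = 0`, and then both terms count. -/
def linCoef (k a b : ℕ) : ℝ :=
  chebNorm k * chebNorm a / (2 * chebNorm b) *
    ((if b = k + a then 1 else 0) + (if b = (k - a) + (a - k) then 1 else 0))

theorem chebT_mul_chebT (k a : ℕ) {L : ℕ} (hL : k + a < L) (x : ℝ) :
    chebT k x * chebT a x = ∑ b ∈ Finset.range L, linCoef k a b * chebT b x := by
  have hT : ∀ b : ℕ, linCoef k a b * chebT b x =
      (if b = k + a then chebNorm k * chebNorm a / 2 *
        (Polynomial.Chebyshev.T ℝ (b : ℤ)).eval x else 0) +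
      (if b = (k - a) + (a - k) then chebNorm k * chebNorm a / 2 *
        (Polynomial.Chebyshev.T ℝ (b : ℤ)).eval x else 0) := by
    intro b
    have := (chebNorm_pos b).ne'
    rw [linCoef, chebT_eq]
    split_ifs <;> field_simp <;> ring
  simp_rw [hT]
  rw [Finset.sum_add_distrib, Finset.sum_ite_eq', Finset.sum_ite_eq',
    if_pos (Finset.mem_range.mpr hL), if_pos (Finset.mem_range.mpr (by omega)), chebT_eq, chebT_eq]
  have h := congrArg (Polynomial.eval x) (Polynomial.Chebyshev.T_mul_T ℝ (k : ℤ) (a : ℤ))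
  have h2 : Polynomial.Chebyshev.T ℝ ((k : ℤ) - a) =
      Polynomial.Chebyshev.T ℝ (((k - a) + (a - k) : ℕ) : ℤ) := by
    rcases le_total a k with hak | hak
    · congr 1; omega
    · rw [← Polynomial.Chebyshev.T_neg]; congr 1; omega
  rw [h2] at h
  simp only [Polynomial.eval_mul, Polynomial.eval_add, Polynomial.eval_ofNat] at h
  push_cast at h ⊢
  linear_combination (chebNorm k * chebNorm a / 2) * h

theorem abs_linCoef_le (k a b : ℕ) : |linCoef k a b| ≤ 2 := by
  have hk := chebNorm_sq_le k
  have ha := chebNorm_sq_le a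
  have hb := one_le_chebNorm b
  have hk0 := chebNorm_pos k
  have ha0 := chebNorm_pos a
  have h2 : chebNorm k * chebNorm a / (2 * chebNorm b) ≤ 1 := by
    rw [div_le_one (by positivity)]
    nlinarith [sq_nonneg (chebNorm k - chebNorm a)]
  have h0 : 0 ≤ chebNorm k * chebNorm a / (2 * chebNorm b) := by positivity
  rw [linCoef, abs_mul, abs_of_nonneg h0]
  have : |((if b = k + a then 1 else 0) + (if b = (k - a) + (a - k) then 1 else 0) : ℝ)| ≤ 2 := by
    split_ifs <;> norm_num
  nlinarith [abs_nonneg ((if b = k + a then 1 else 0) + (if b = (k - a) + (a - k) then 1 else 0) : ℝ)]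

theorem linCoef_eq_zero {k a b : ℕ} (h : a + k < b ∨ b + k < a) : linCoef k a b = 0 := by
  rw [linCoef, if_neg (by omega), if_neg (by omega)]
  ring

/-- Away from the origin the squared coefficients are the transition probabilities of the random
walk with steps `±k`, and the coefficients for different `k` have disjoint supports. -/
theorem linCoef_mul_linCoef {k l a b : ℕ} (hk : k < a) (hl : l < a) :
    linCoef k a b * linCoef l a b =
      if k = l then 1 / 2 * ((if b = a + k then 1 else 0) + (if b + k = a then 1 else 0)) else 0 := by
  unfold linCoef
  by_cases hkl : k = l
  · subst hkl
    rw [if_pos rfl]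
    by_cases h0 : k = 0
    · subst h0
      by_cases hb : b = a
      · subst hb
        have := chebNorm_sq (n := b) (by omega)
        have h3 := (chebNorm_pos b).ne'
        have : chebNorm 0 = 1 := by simp [chebNorm]
        simp [this]
        field_simp
        norm_num
      · simp [hb]
    · have h1 := chebNorm_sq (n := k) (by omega)
      have h2 := chebNorm_sq (n := a) (by omega)
      by_cases hb : b = a + k
      · have h3 := chebNorm_sq (n := b) (by omega)
        have := (chebNorm_pos b).ne'
        rw [if_pos (by omega), if_neg (by omega), if_pos hb, if_neg (by omega)]
        field_simp
        rw [h1, h2, h3]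
        norm_num
      · by_cases hb' : b + k = a
        · have h3 := chebNorm_sq (n := b) (by omega)
          have := (chebNorm_pos b).ne'
          rw [if_neg (by omega), if_pos (by omega), if_neg hb, if_pos hb']
          field_simp
          rw [h1, h2, h3]
          norm_num
        · rw [if_neg (by omega), if_neg (by omega), if_neg hb, if_neg hb']
          ring
  · rw [if_neg hkl]
    by_cases h : b = k + a ∨ b = (k - a) + (a - k)
    · rw [if_neg (c := b = l + a) (by omega), if_neg (c := b = (l - a) + (a - l)) (by omega)]
      ring
    · rw [if_neg (c := b = k + a) (by omega), if_neg (c := b = (k - a) + (a - k)) (by omega)]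
      ring

/-- Monomials expand in Chebyshev polynomials with a positive leading coefficient. -/
theorem exists_pow_eq_sum_chebT (n : ℕ) :
    ∃ c : ℕ → ℝ, 0 < c n ∧ ∀ x : ℝ, x ^ n = ∑ m ∈ Finset.range (n + 1), c m * chebT m x := by
  induction n with
  | zero => exact ⟨fun _ => 1, one_pos, fun x => by simp [chebT]⟩
  | succ n ih =>
    obtain ⟨c, hc, h⟩ := ih
    have hT1 : ∀ x, chebT 1 x = √2 * x := fun x => by simp [chebT]
    refine ⟨fun b => ∑ m ∈ Finset.range (n + 1), c m * (√2)⁻¹ * linCoef 1 m b, ?_, fun x => ?_⟩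
    · beta_reduce
      rw [Finset.sum_range_succ, Finset.sum_eq_zero, zero_add]
      · refine mul_pos (by positivity) ?_
        rw [linCoef, if_pos (by omega)]
        have h1 := chebNorm_pos 1
        have h2 := chebNorm_pos n
        have h3 := chebNorm_pos (n + 1)
        positivity
      · intro m hm
        rw [linCoef_eq_zero (by have := Finset.mem_range.mp hm; omega), mul_zero]
    · rw [pow_succ, h, Finset.sum_mul]
      simp_rw [Finset.sum_mul]
      rw [Finset.sum_comm]
      refine Finset.sum_congr rfl fun m hm => ?_
      have hx : x = (√2)⁻¹ * chebT 1 x := by rw [hT1]; field_simp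
      have := chebT_mul_chebT 1 m (L := n + 1 + 1) (by have := Finset.mem_range.mp hm; omega) x
      calc c m * chebT m x * x = c m * (√2)⁻¹ * (chebT 1 x * chebT m x) := by
            nth_rewrite 2 [hx]; ring
        _ = _ := by
            rw [this, Finset.mul_sum]
            exact Finset.sum_congr rfl fun b _ => by ring

end

/-! ### Linear statistics of determinantal projection ensembles -/

section

/-- In the Leibniz formula only the identity and the transposition of `a` and `b` survive. -/
theorem det_of_rows_eq_one_off_pair {n : Type*} [Fintype n] [DecidableEq n] (M : Matrix n n ℝ)
    (a b : n) (hM : ∀ i j, i ≠ a → i ≠ b → M i j = if i = j then 1 else 0) :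
    M.det = if a = b then M a a else M a a * M b b - M a b * M b a := by
  rw [← Matrix.det_transpose, Matrix.det_apply']
  simp only [Matrix.transpose_apply]
  have hfix : ∀ ρ : Equiv.Perm n, (∏ i, M i (ρ i)) ≠ 0 → ∀ i, i ≠ a → i ≠ b → ρ i = i := by
    intro ρ h i hia hib
    by_contra hne
    exact h (Finset.prod_eq_zero (Finset.mem_univ i) (by rw [hM _ _ hia hib, if_neg (Ne.symm hne)]))
  have hone : (∏ i, M i i) = ∏ i ∈ ({a, b} : Finset n), M i i := by
    symm
    refine Finset.prod_subset (Finset.subset_univ _) fun i _ hi => ?_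
    simp only [Finset.mem_insert, Finset.mem_singleton, not_or] at hi
    rw [hM _ _ hi.1 hi.2, if_pos rfl]
  split_ifs with hab
  · subst hab
    rw [Finset.sum_eq_single 1]
    · simp [hone]
    · intro ρ _ hρ
      by_contra h
      apply hρ
      have hf := hfix ρ (right_ne_zero_of_mul h)
      ext i
      by_cases hi : i = a
      · subst hi
        by_contra hne
        have h2 := hf (ρ i) hne hne
        exact hne (ρ.injective h2)
      · rw [hf i hi hi]; rfl
    · simp
  · have hne : (1 : Equiv.Perm n) ≠ Equiv.swap a b := by
      intro h
      have := congrArg (fun e => e a) h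
      simp only [Equiv.swap_apply_left, Equiv.Perm.one_apply] at this
      exact hab this
    rw [← Finset.sum_subset (Finset.subset_univ {1, Equiv.swap a b}), Finset.sum_pair hne]
    · have hsw : (∏ i, M i (Equiv.swap a b i)) =
          ∏ i ∈ ({a, b} : Finset n), M i (Equiv.swap a b i) := by
        symm
        refine Finset.prod_subset (Finset.subset_univ _) fun i _ hi => ?_
        simp only [Finset.mem_insert, Finset.mem_singleton, not_or] at hi
        rw [Equiv.swap_apply_of_ne_of_ne hi.1 hi.2, hM _ _ hi.1 hi.2, if_pos rfl]
      rw [hsw, Finset.prod_pair hab]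
      simp only [Equiv.Perm.sign_one, Equiv.Perm.one_apply, hone, Finset.prod_pair hab,
        Equiv.Perm.sign_swap hab, Equiv.swap_apply_left, Equiv.swap_apply_right]
      push_cast
      ring
    · intro ρ _ hρ
      by_contra h
      have hf := hfix ρ (right_ne_zero_of_mul h)
      have hmem : ∀ i, i = a ∨ i = b → ρ i = a ∨ ρ i = b := by
        intro i hi
        by_contra hcon
        push Not at hcon
        have := ρ.injective (hf (ρ i) hcon.1 hcon.2)
        rw [this] at hcon
        tauto
      apply hρ
      simp only [Finset.mem_insert, Finset.mem_singleton]
      rcases hmem a (Or.inl rfl) with h1 | h1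
      · left
        ext i
        by_cases hia : i = a
        · rw [hia, h1]; rfl
        · by_cases hib : i = b
          · rcases hmem b (Or.inr rfl) with h2 | h2
            · exact absurd (ρ.injective (h1.trans h2.symm)) hab
            · rw [hib, h2]; rfl
          · rw [hf i hia hib]; rfl
      · right
        ext i
        by_cases hia : i = a
        · rw [hia, h1, Equiv.swap_apply_left]
        · by_cases hib : i = b
          · rcases hmem b (Or.inr rfl) with h2 | h2
            · rw [hib, h2, Equiv.swap_apply_right]
            · exact absurd (ρ.injective (h1.trans h2.symm)) hab
          · rw [hf i hia hib, Equiv.swap_apply_of_ne_of_ne hia hib]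

section ProjectionEnsemble

variable {X : Type*} {N : ℕ}

theorem det_sq_eq_sum (u : Fin N → X → ℝ) (x : Fin N → X) :
    (Matrix.of fun i n => u n (x i)).det ^ 2 =
      ∑ σ : Equiv.Perm (Fin N), ∑ τ : Equiv.Perm (Fin N),
        ((σ.sign : ℤ) : ℝ) * ((τ.sign : ℤ) : ℝ) * ∏ i, (u (σ i) (x i) * u (τ i) (x i)) := by
  rw [← Matrix.det_transpose, Matrix.det_apply', sq, Finset.sum_mul_sum]
  refine Finset.sum_congr rfl fun σ _ => Finset.sum_congr rfl fun τ _ => ?_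
  simp only [Matrix.transpose_apply, Matrix.of_apply]
  rw [Finset.prod_mul_distrib]
  ring

theorem prod_mul_det_sq_eq_sum (u h : Fin N → X → ℝ) (x : Fin N → X) :
    (∏ i, h i (x i)) * (Matrix.of fun i n => u n (x i)).det ^ 2 =
      ∑ σ : Equiv.Perm (Fin N), ∑ τ : Equiv.Perm (Fin N),
        ((σ.sign : ℤ) : ℝ) * ((τ.sign : ℤ) : ℝ) *
          ∏ i, (h i (x i) * (u (σ i) (x i) * u (τ i) (x i))) := by
  rw [det_sq_eq_sum, Finset.mul_sum]
  simp_rw [Finset.mul_sum]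
  refine Finset.sum_congr rfl fun σ _ => Finset.sum_congr rfl fun τ _ => ?_
  rw [Finset.prod_mul_distrib (f := fun i => h i (x i))]
  ring

theorem sum_perm_apply_pair (G : Fin N → Fin N → ℝ) :
    ∑ a, ∑ b, ∑ σ : Equiv.Perm (Fin N), G (σ a) (σ b) = (N ! : ℝ) * ∑ n, ∑ m, G n m := by
  have h1 : ∀ σ : Equiv.Perm (Fin N), ∑ a, ∑ b, G (σ a) (σ b) = ∑ n, ∑ m, G n m := fun σ => by
    rw [← Equiv.sum_comp σ fun n => ∑ m, G n m]
    exact Finset.sum_congr rfl fun a _ => Equiv.sum_comp σ (fun m => G (σ a) m)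
  calc ∑ a, ∑ b, ∑ σ : Equiv.Perm (Fin N), G (σ a) (σ b)
      = ∑ a, ∑ σ : Equiv.Perm (Fin N), ∑ b, G (σ a) (σ b) :=
        Finset.sum_congr rfl fun a _ => Finset.sum_comm
    _ = ∑ σ : Equiv.Perm (Fin N), ∑ a, ∑ b, G (σ a) (σ b) := Finset.sum_comm
    _ = _ := by
        simp_rw [h1]
        rw [Finset.sum_const, nsmul_eq_mul, Finset.card_univ, Fintype.card_perm, Fintype.card_fin]

theorem sum_perm_apply (G : Fin N → ℝ) :
    ∑ a, ∑ σ : Equiv.Perm (Fin N), G (σ a) = (N ! : ℝ) * ∑ n, G n := by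
  rw [Finset.sum_comm]
  simp_rw [fun σ : Equiv.Perm (Fin N) => Equiv.sum_comp σ G]
  rw [Finset.sum_const, nsmul_eq_mul, Finset.card_univ, Fintype.card_perm, Fintype.card_fin]

/-- The factors of the function `x ↦ f (x a) * g (x b)`, one for each point. The case `a = b` is
included. -/
def pairFactor (f g : X → ℝ) (a b i : Fin N) (x : X) : ℝ :=
  (if i = a then f x else 1) * (if i = b then g x else 1)

theorem prod_pairFactor (f g : X → ℝ) (a b : Fin N) (x : Fin N → X) :
    ∏ i, pairFactor f g a b i (x i) = f (x a) * g (x b) := by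
  simp only [pairFactor]
  rw [Finset.prod_mul_distrib, Finset.prod_ite_eq' Finset.univ a fun i => f (x i),
    Finset.prod_ite_eq' Finset.univ b fun i => g (x i)]
  simp

variable [MeasurableSpace X] {μ : Measure X} [SigmaFinite μ] {u : Fin N → X → ℝ}

theorem integrable_prod_mul_det_sq {h : Fin N → X → ℝ}
    (hi : ∀ i n m, Integrable (fun x => h i x * (u n x * u m x)) μ) :
    Integrable (fun x : Fin N → X => (∏ i, h i (x i)) *
      (Matrix.of fun i n => u n (x i)).det ^ 2) (Measure.pi fun _ => μ) := by
  simp_rw [prod_mul_det_sq_eq_sum]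
  refine integrable_finsetSum _ fun σ _ => integrable_finsetSum _ fun τ _ => ?_
  exact (Integrable.fintype_prod (f := fun i x => h i x * (u (σ i) x * u (τ i) x))
    fun i => hi i _ _).const_mul _

/-- A form of Andréief's identity. -/
theorem integral_prod_mul_det_sq {h : Fin N → X → ℝ}
    (hi : ∀ i n m, Integrable (fun x => h i x * (u n x * u m x)) μ) :
    ∫ x : Fin N → X, (∏ i, h i (x i)) * (Matrix.of fun i n => u n (x i)).det ^ 2
      ∂(Measure.pi fun _ => μ) =
    ∑ σ : Equiv.Perm (Fin N),
      (Matrix.of fun i j => ∫ x, h i x * (u (σ i) x * u (σ j) x) ∂μ).det := by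
  have hint : ∀ σ τ : Equiv.Perm (Fin N), Integrable (fun x : Fin N → X =>
      ((σ.sign : ℤ) : ℝ) * ((τ.sign : ℤ) : ℝ) *
          ∏ i, (h i (x i) * (u (σ i) (x i) * u (τ i) (x i)))) (Measure.pi fun _ => μ) :=
    fun σ τ => (Integrable.fintype_prod (f := fun i x => h i x * (u (σ i) x * u (τ i) x))
      fun i => hi i _ _).const_mul _
  simp_rw [prod_mul_det_sq_eq_sum]
  rw [integral_finsetSum _ fun σ _ => integrable_finsetSum _ fun τ _ => hint σ τ]
  refine Finset.sum_congr rfl fun σ _ => ?_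
  -- The substitution `τ = σ * ρ` turns the inner sum into a Leibniz expansion over `ρ`.
  rw [integral_finsetSum _ fun τ _ => hint σ τ, ← Matrix.det_transpose, Matrix.det_apply',
    ← Equiv.sum_comp (Equiv.mulLeft σ)]
  refine Finset.sum_congr rfl fun ρ _ => ?_
  rw [integral_const_mul, integral_fintype_prod_eq_prod
    (fun i x => h i x * (u (σ i) x * u ((Equiv.mulLeft σ ρ) i) x))]
  have hs : ((σ.sign : ℤ) : ℝ) * ((σ.sign : ℤ) : ℝ) = 1 := by
    rcases Int.units_eq_one_or σ.sign with h | h <;> simp [h]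
  simp only [Equiv.coe_mulLeft, Equiv.Perm.sign_mul, Units.val_mul, Int.cast_mul,
    Equiv.Perm.mul_apply, Matrix.transpose_apply, Matrix.of_apply]
  rw [← mul_assoc, hs, one_mul]

/-- The functions `f` and `g` have all the moments against products of the `u n` that the
second-order statistics of the ensemble involve. -/
structure IntegrableAgainst (μ : Measure X) (u : Fin N → X → ℝ) (f g : X → ℝ) : Prop where
  one : ∀ n m, Integrable (fun x => u n x * u m x) μ
  left : ∀ n m, Integrable (fun x => f x * (u n x * u m x)) μ
  right : ∀ n m, Integrable (fun x => g x * (u n x * u m x)) μ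
  mul : ∀ n m, Integrable (fun x => f x * g x * (u n x * u m x)) μ

variable {f g : X → ℝ}

omit [SigmaFinite μ] in
theorem IntegrableAgainst.pairFactor (H : IntegrableAgainst μ u f g) (a b i n m : Fin N) :
    Integrable (fun x => pairFactor f g a b i x * (u n x * u m x)) μ := by
  unfold OPEnsemble.pairFactor
  split_ifs
  · exact H.mul n m
  · simpa using H.left n m
  · simpa using H.right n m
  · simpa using H.one n m

/-- By orthonormality, all rows but `a` and `b` of the matrices in Andréief's identity are rows of
the identity matrix. -/
theorem integral_pair_mul_det_sq (H : IntegrableAgainst μ u f g)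
    (horth : ∀ n m, ∫ x, u n x * u m x ∂μ = if n = m then 1 else 0) (a b : Fin N) :
    ∫ x : Fin N → X, f (x a) * g (x b) * (Matrix.of fun i n => u n (x i)).det ^ 2
      ∂(Measure.pi fun _ => μ) =
    ∑ σ : Equiv.Perm (Fin N), if a = b then ∫ x, f x * g x * (u (σ a) x * u (σ a) x) ∂μ else
      (∫ x, f x * (u (σ a) x * u (σ a) x) ∂μ) * (∫ x, g x * (u (σ b) x * u (σ b) x) ∂μ) -
      (∫ x, f x * (u (σ a) x * u (σ b) x) ∂μ) * (∫ x, g x * (u (σ b) x * u (σ a) x) ∂μ) := by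
  simp_rw [← prod_pairFactor f g a b]
  rw [integral_prod_mul_det_sq (H.pairFactor a b)]
  refine Finset.sum_congr rfl fun σ _ => ?_
  rw [det_of_rows_eq_one_off_pair _ a b]
  · split_ifs with hab
    · subst hab
      simp [pairFactor]
    · simp [pairFactor, hab, Ne.symm hab]
  · intro i j hia hib
    simp [pairFactor, hia, hib, horth]

variable (μ u) in
/-- The law with density `det (u n (x i))² / N!` with respect to the product measure. -/
def projEnsemble : Measure (Fin N → X) :=
  (Measure.pi fun _ : Fin N => μ).withDensity fun x =>
    ENNReal.ofReal ((1 / (N ! : ℝ)) * (Matrix.of fun i n => u n (x i)).det ^ 2)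

theorem measurable_density (hu : ∀ n, Measurable (u n)) :
    Measurable fun x : Fin N → X =>
      (1 / (N ! : ℝ)) * (Matrix.of fun i n => u n (x i)).det ^ 2 := by
  simp_rw [det_sq_eq_sum]
  fun_prop

omit [SigmaFinite μ] in
theorem integral_projEnsemble (hu : ∀ n, Measurable (u n)) (F : (Fin N → X) → ℝ) :
    ∫ x, F x ∂(projEnsemble μ u) =
      1 / (N ! : ℝ) * ∫ x, F x * (Matrix.of fun i n => u n (x i)).det ^ 2
        ∂(Measure.pi fun _ => μ) := by
  rw [projEnsemble, integral_withDensity_eq_integral_toReal_smul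
    (measurable_density hu).ennreal_ofReal
    (Eventually.of_forall fun _ => ENNReal.ofReal_lt_top), ← integral_const_mul]
  refine integral_congr_ae (Eventually.of_forall fun x => ?_)
  beta_reduce
  rw [ENNReal.toReal_ofReal (by positivity), smul_eq_mul]
  ring

omit [SigmaFinite μ] in
theorem integrable_projEnsemble (hu : ∀ n, Measurable (u n)) {F : (Fin N → X) → ℝ}
    (hF : Integrable (fun x => F x * (Matrix.of fun i n => u n (x i)).det ^ 2)
      (Measure.pi fun _ => μ)) : Integrable F (projEnsemble μ u) := by
  rw [projEnsemble, integrable_withDensity_iff_integrable_smul'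
    (measurable_density hu).ennreal_ofReal
    (Eventually.of_forall fun _ => ENNReal.ofReal_lt_top)]
  refine (hF.const_mul (1 / (N ! : ℝ))).congr (Eventually.of_forall fun x => ?_)
  beta_reduce
  rw [ENNReal.toReal_ofReal (by positivity), smul_eq_mul]
  ring

theorem isProbabilityMeasure_projEnsemble (hu : ∀ n, Measurable (u n))
    (hint : ∀ n m, Integrable (fun x => u n x * u m x) μ)
    (horth : ∀ n m, ∫ x, u n x * u m x ∂μ = if n = m then 1 else 0) :
    IsProbabilityMeasure (projEnsemble μ u) := by
  have hi : ∀ i n m : Fin N, Integrable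
      (fun x => (fun (_ : Fin N) (_ : X) => (1 : ℝ)) i x * (u n x * u m x)) μ := by
    simpa using fun _ => hint
  have h1 := integrable_projEnsemble hu (F := fun _ => 1) (by
    simpa using integrable_prod_mul_det_sq hi)
  have h2 : ∫ _, (1 : ℝ) ∂(projEnsemble μ u) = 1 := by
    rw [integral_projEnsemble hu]
    have h3 := integral_prod_mul_det_sq hi
    simp only [Finset.prod_const_one, one_mul, horth] at h3 ⊢
    rw [h3]
    have h4 : ∀ σ : Equiv.Perm (Fin N),
        (Matrix.of fun i j => if σ i = σ j then (1 : ℝ) else 0) = 1 := by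
      intro σ
      ext i j
      simp [Matrix.one_apply]
    simp_rw [h4]
    simp [Fintype.card_perm, Nat.factorial_ne_zero]
  have : IsFiniteMeasure (projEnsemble μ u) := by
    rw [integrable_const_iff] at h1
    simpa using h1
  refine ⟨?_⟩
  rw [integral_const, smul_eq_mul, mul_one, measureReal_def] at h2
  rwa [ENNReal.toReal_eq_one_iff] at h2

theorem integrable_pair_projEnsemble (hu : ∀ n, Measurable (u n)) (H : IntegrableAgainst μ u f g)
    (a b : Fin N) : Integrable (fun x => f (x a) * g (x b)) (projEnsemble μ u) := by
  refine integrable_projEnsemble hu ?_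
  simp_rw [← prod_pairFactor f g a b]
  exact integrable_prod_mul_det_sq (H.pairFactor a b)

theorem memLp_linearStatistic (hu : ∀ n, Measurable (u n)) (hf : Measurable f)
    (H : IntegrableAgainst μ u f f) :
    MemLp (fun x : Fin N → X => ∑ i, f (x i)) 2 (projEnsemble μ u) := by
  rw [memLp_two_iff_integrable_sq (Measurable.aestronglyMeasurable (by fun_prop))]
  simp_rw [sq, Finset.sum_mul_sum]
  exact integrable_finsetSum _ fun a _ => integrable_finsetSum _ fun b _ =>
    integrable_pair_projEnsemble hu H a b

theorem integral_linearStatistic (hu : ∀ n, Measurable (u n)) (H : IntegrableAgainst μ u f f)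
    (horth : ∀ n m, ∫ x, u n x * u m x ∂μ = if n = m then 1 else 0) :
    ∫ x, ∑ i, f (x i) ∂(projEnsemble μ u) = ∑ n, ∫ x, f x * (u n x * u n x) ∂μ := by
  have H1 : IntegrableAgainst μ u f (fun _ => 1) :=
    ⟨H.one, H.left, by simpa using H.one, by simpa using H.left⟩
  have hi := fun a => integrable_pair_projEnsemble hu H1 a a
  have hv := fun a => integral_pair_mul_det_sq H1 horth a a
  simp only [mul_one, if_true] at hi hv
  rw [integral_finsetSum _ fun a _ => hi a]
  simp_rw [integral_projEnsemble hu, hv]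
  rw [← Finset.mul_sum, sum_perm_apply fun n => ∫ x, f x * (u n x * u n x) ∂μ]
  have := Nat.factorial_ne_zero N
  field_simp

/-- The covariance of two linear statistics of a determinantal projection ensemble. -/
theorem covariance_linearStatistic (hu : ∀ n, Measurable (u n)) (hf : Measurable f)
    (hg : Measurable g) (Hf : IntegrableAgainst μ u f f) (Hg : IntegrableAgainst μ u g g)
    (H : IntegrableAgainst μ u f g)
    (horth : ∀ n m, ∫ x, u n x * u m x ∂μ = if n = m then 1 else 0) :
    covariance (fun x => ∑ i, f (x i)) (fun x => ∑ i, g (x i)) (projEnsemble μ u) =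
      ∑ n, ∫ x, f x * g x * (u n x * u n x) ∂μ -
        ∑ n, ∑ m, (∫ x, f x * (u n x * u m x) ∂μ) * (∫ x, g x * (u m x * u n x) ∂μ) := by
  have := isProbabilityMeasure_projEnsemble hu H.one horth
  rw [covariance_eq_sub (memLp_linearStatistic hu hf Hf) (memLp_linearStatistic hu hg Hg),
    integral_linearStatistic hu Hf horth, integral_linearStatistic hu Hg horth]
  simp only [Pi.mul_apply]
  simp_rw [Finset.sum_mul_sum]
  rw [integral_finsetSum _ fun a _ => integrable_finsetSum _ fun b _ =>
    integrable_pair_projEnsemble hu H a b]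
  simp_rw [fun a => integral_finsetSum Finset.univ fun b _ =>
    integrable_pair_projEnsemble hu H a b, integral_projEnsemble hu,
    integral_pair_mul_det_sq H horth]
  simp_rw [← Finset.mul_sum]
  -- On the diagonal the `2 × 2` minor vanishes, so it may be added to the terms with `a = b`.
  have hG := sum_perm_apply_pair (N := N) fun n m =>
    (if n = m then ∫ x, f x * g x * (u n x * u n x) ∂μ else 0) +
    ((∫ x, f x * (u n x * u n x) ∂μ) * (∫ x, g x * (u m x * u m x) ∂μ) -
      (∫ x, f x * (u n x * u m x) ∂μ) * (∫ x, g x * (u m x * u n x) ∂μ))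
  have hterm : ∀ (a b : Fin N) (σ : Equiv.Perm (Fin N)),
      (if a = b then ∫ x, f x * g x * (u (σ a) x * u (σ a) x) ∂μ else
      (∫ x, f x * (u (σ a) x * u (σ a) x) ∂μ) * (∫ x, g x * (u (σ b) x * u (σ b) x) ∂μ) -
      (∫ x, f x * (u (σ a) x * u (σ b) x) ∂μ) * (∫ x, g x * (u (σ b) x * u (σ a) x) ∂μ)) =
      (if σ a = σ b then ∫ x, f x * g x * (u (σ a) x * u (σ a) x) ∂μ else 0) +
      ((∫ x, f x * (u (σ a) x * u (σ a) x) ∂μ) * (∫ x, g x * (u (σ b) x * u (σ b) x) ∂μ) -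
      (∫ x, f x * (u (σ a) x * u (σ b) x) ∂μ) * (∫ x, g x * (u (σ b) x * u (σ a) x) ∂μ)) := by
    intro a b σ
    by_cases hab : a = b
    · subst hab; simp
    · simp [hab]
  simp_rw [hterm]
  rw [hG]
  simp only [Finset.sum_add_distrib, Finset.sum_sub_distrib, Finset.sum_ite_eq, Finset.mem_univ,
    if_true]
  rw [one_div, inv_mul_cancel_left₀ (Nat.cast_ne_zero.mpr (Nat.factorial_ne_zero N))]
  simp_rw [← Finset.mul_sum, ← Finset.sum_mul]
  ring

end ProjectionEnsemble

end

/-! ### The orthonormal polynomials of the product measure -/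

section

variable {d : ℕ}

theorem gradedLexKey_injective : Function.Injective (gradedLexKey (d := d)) := by
  intro α β h
  have h' := congrArg (fun p => ofLex (ofLex p).2) h
  simpa [gradedLexKey] using h'

theorem gradedLexKey_lt_iff {α β : Fin d → ℕ} : gradedLexKey α < gradedLexKey β ↔
    Finset.univ.sup α < Finset.univ.sup β ∨
      Finset.univ.sup α = Finset.univ.sup β ∧ toLex α < toLex β := by
  simp [gradedLexKey, Prod.Lex.toLex_lt_toLex]

theorem gradedLexKey_lt_of_lt {α β : Fin d → ℕ} (h : α < β) :
    gradedLexKey α < gradedLexKey β := by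
  rw [gradedLexKey_lt_iff]
  have h1 : Finset.univ.sup α ≤ Finset.univ.sup β := Finset.sup_mono_fun fun j _ => h.le j
  rcases h1.lt_or_eq with h2 | h2
  · exact Or.inl h2
  · exact Or.inr ⟨h2, Pi.toLex_strictMono h⟩

section Enumeration

variable [NeZero d]

theorem gradedLexEnum_ne {n m : ℕ} (h : n < m) : gradedLexEnum d n ≠ gradedLexEnum d m := by
  have := Function.argminOn_mem gradedLexKey {α : Fin d → ℕ | ∀ k : Fin m, gradedLexEnum d k ≠ α}
    (exists_notMem_range fun k : Fin m => gradedLexEnum d k)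
  rw [← gradedLexEnum] at this
  exact this ⟨n, h⟩

theorem gradedLexKey_gradedLexEnum_le {n : ℕ} {α : Fin d → ℕ}
    (h : ∀ k < n, gradedLexEnum d k ≠ α) :
    gradedLexKey (gradedLexEnum d n) ≤ gradedLexKey α := by
  have := Function.argminOn_le gradedLexKey {α : Fin d → ℕ | ∀ k : Fin n, gradedLexEnum d k ≠ α}
    (a := α) (fun k => h k k.2)
  rwa [← gradedLexEnum] at this

theorem gradedLexKey_gradedLexEnum_strictMono :
    StrictMono fun n => gradedLexKey (gradedLexEnum d n) := by
  intro n m h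
  refine lt_of_le_of_ne (gradedLexKey_gradedLexEnum_le fun k hk => gradedLexEnum_ne (hk.trans h))
    fun he => gradedLexEnum_ne h (gradedLexKey_injective he)

theorem gradedLexEnum_injective : Function.Injective (gradedLexEnum d) := fun _ _ h =>
  gradedLexKey_gradedLexEnum_strictMono.injective (congrArg gradedLexKey h)

theorem exists_gradedLexEnum_eq {n : ℕ} {α : Fin d → ℕ}
    (h : gradedLexKey α < gradedLexKey (gradedLexEnum d n)) : ∃ k < n, gradedLexEnum d k = α := by
  by_contra hcon
  push Not at hcon
  exact absurd (gradedLexKey_gradedLexEnum_le hcon) (not_le.mpr h)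

variable (d) in
/-- The first `N` multi-indices in the graded lexicographic order. -/
def initialSegment (N : ℕ) : Finset (Fin d → ℕ) := (Finset.range N).image (gradedLexEnum d)

theorem mem_initialSegment {N : ℕ} {α : Fin d → ℕ} :
    α ∈ initialSegment d N ↔ gradedLexKey α < gradedLexKey (gradedLexEnum d N) := by
  rw [initialSegment, Finset.mem_image]
  constructor
  · rintro ⟨k, hk, rfl⟩
    exact gradedLexKey_gradedLexEnum_strictMono (Finset.mem_range.mp hk)
  · intro h
    obtain ⟨k, hk, h⟩ := exists_gradedLexEnum_eq h
    exact ⟨k, Finset.mem_range.mpr hk, h⟩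

theorem card_initialSegment (N : ℕ) : (initialSegment d N).card = N := by
  rw [initialSegment, Finset.card_image_of_injective _ gradedLexEnum_injective, Finset.card_range]

theorem sum_fin_gradedLexEnum {N : ℕ} (F : (Fin d → ℕ) → ℝ) :
    ∑ n : Fin N, F (gradedLexEnum d n) = ∑ α ∈ initialSegment d N, F α := by
  rw [initialSegment, Finset.sum_image fun _ _ _ _ h => gradedLexEnum_injective h,
    Finset.sum_range]

end Enumeration

instance isProbabilityMeasure_muEqProd : IsProbabilityMeasure (muEqProd d) := by
  unfold muEqProd
  infer_instance

theorem integrable_prod_muEqProd {F : Fin d → ℝ → ℝ} (hF : ∀ j, Continuous (F j)) :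
    Integrable (fun x : Fin d → ℝ => ∏ j, F j (x j)) (muEqProd d) :=
  Integrable.fintype_prod fun j => integrable_muEq (hF j)

theorem measurable_multiChebT (k : Fin d → ℕ) : Measurable (multiChebT k) := by
  unfold multiChebT
  have := fun j => (continuous_chebT (k j)).measurable
  fun_prop

theorem integrable_multiChebT_mul (α β : Fin d → ℕ) :
    Integrable (fun x => multiChebT α x * multiChebT β x) (muEqProd d) := by
  simp only [multiChebT, ← Finset.prod_mul_distrib]
  exact integrable_prod_muEqProd (F := fun j y => chebT (α j) y * chebT (β j) y)
    fun j => by fun_prop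

theorem integrable_multiChebT_mul_mul (k α β : Fin d → ℕ) :
    Integrable (fun x => multiChebT k x * (multiChebT α x * multiChebT β x)) (muEqProd d) := by
  simp only [multiChebT, ← Finset.prod_mul_distrib]
  exact integrable_prod_muEqProd
    (F := fun j y => chebT (k j) y * (chebT (α j) y * chebT (β j) y)) fun j => by fun_prop

theorem integrable_multiChebT_mul_mul_mul (k l α β : Fin d → ℕ) :
    Integrable (fun x => multiChebT k x * multiChebT l x * (multiChebT α x * multiChebT β x))
      (muEqProd d) := by
  simp only [multiChebT, ← Finset.prod_mul_distrib]
  exact integrable_prod_muEqProd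
    (F := fun j y => chebT (k j) y * chebT (l j) y * (chebT (α j) y * chebT (β j) y))
    fun j => by fun_prop

theorem integral_multiChebT_mul_multiChebT (α β : Fin d → ℕ) :
    ∫ x, multiChebT α x * multiChebT β x ∂(muEqProd d) = if α = β then 1 else 0 := by
  simp only [multiChebT, ← Finset.prod_mul_distrib]
  rw [muEqProd, integral_fintype_prod_eq_prod (fun j y => chebT (α j) y * chebT (β j) y)]
  simp_rw [integral_chebT_mul_chebT]
  rw [Finset.prod_ite_zero]
  simp [funext_iff]

/-- The coefficient of `multiChebT β` in the expansion of `multiChebT k * multiChebT α`. -/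
def multiCoef (k α β : Fin d → ℕ) : ℝ := ∏ j, linCoef (k j) (α j) (β j)

variable (d) in
/-- The multi-indices with all entries smaller than `L`. -/
def box (L : ℕ) : Finset (Fin d → ℕ) := Fintype.piFinset fun _ => Finset.range L

theorem mem_box {L : ℕ} {β : Fin d → ℕ} : β ∈ box d L ↔ ∀ j, β j < L := by
  simp [box, Fintype.mem_piFinset]

theorem multiChebT_mul_multiChebT {k α : Fin d → ℕ} {L : ℕ} (hL : ∀ j, k j + α j < L)
    (x : Fin d → ℝ) :
    multiChebT k x * multiChebT α x = ∑ β ∈ box d L, multiCoef k α β * multiChebT β x := by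
  simp only [multiChebT, multiCoef, ← Finset.prod_mul_distrib]
  simp_rw [fun j => chebT_mul_chebT (k j) (α j) (hL j) (x j)]
  rw [Finset.prod_univ_sum]
  rfl

theorem exists_lt_of_add {k α : Fin d → ℕ} : ∃ L, ∀ j, k j + α j < L :=
  ⟨Finset.univ.sup (fun j => k j + α j) + 1, fun j => Nat.lt_succ_of_le
    (Finset.le_sup (f := fun j => k j + α j) (Finset.mem_univ j))⟩

theorem integral_multiChebT_mul_mul {k α β : Fin d → ℕ} :
    ∫ x, multiChebT k x * (multiChebT α x * multiChebT β x) ∂(muEqProd d) = multiCoef k α β := by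
  obtain ⟨L, hL⟩ := exists_lt_of_add (k := k + β) (α := α)
  have hL' : ∀ j, k j + α j < L := fun j => by have := hL j; simp at this; omega
  simp_rw [← mul_assoc, multiChebT_mul_multiChebT hL', Finset.sum_mul, mul_assoc]
  rw [integral_finsetSum _ fun γ _ => (integrable_multiChebT_mul γ β).const_mul _]
  simp_rw [integral_const_mul, integral_multiChebT_mul_multiChebT]
  simp only [mul_ite, mul_one, mul_zero]
  rw [Finset.sum_ite_eq', if_pos (mem_box.mpr fun j => by have := hL j; simp at this; omega)]

theorem multiCoef_comm (k α β : Fin d → ℕ) : multiCoef k α β = multiCoef k β α := by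
  rw [← integral_multiChebT_mul_mul, ← integral_multiChebT_mul_mul]
  simp_rw [mul_comm (multiChebT α _)]

/-- Parseval's identity for the products `T_k T_α` and `T_l T_α`. -/
theorem integral_multiChebT_mul_mul_mul {k l α : Fin d → ℕ} {L : ℕ}
    (hk : ∀ j, k j + α j < L) :
    ∫ x, multiChebT k x * multiChebT l x * (multiChebT α x * multiChebT α x) ∂(muEqProd d) =
      ∑ β ∈ box d L, multiCoef k α β * multiCoef l α β := by
  have h : ∀ x, multiChebT k x * multiChebT l x * (multiChebT α x * multiChebT α x) =
      ∑ β ∈ box d L, multiCoef k α β * (multiChebT l x * (multiChebT α x * multiChebT β x)) := by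
    intro x
    calc _ = (multiChebT k x * multiChebT α x) * (multiChebT l x * multiChebT α x) := by ring
      _ = _ := by
        rw [multiChebT_mul_multiChebT hk, Finset.sum_mul]
        exact Finset.sum_congr rfl fun β _ => by ring
  simp_rw [h]
  rw [integral_finsetSum _ fun β _ => (integrable_multiChebT_mul_mul l α β).const_mul _]
  simp_rw [integral_const_mul, integral_multiChebT_mul_mul]

theorem exists_monomialFun_eq_sum (α : Fin d → ℕ) :
    ∃ c : (Fin d → ℕ) → ℝ, 0 < c α ∧ ∀ x : Fin d → ℝ,
      monomialFun α x = ∑ β ∈ Finset.Iic α, c β * multiChebT β x := by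
  choose c hc h using exists_pow_eq_sum_chebT
  refine ⟨fun β => ∏ j, c (α j) (β j), Finset.prod_pos fun j _ => hc _, fun x => ?_⟩
  simp only [multiChebT, monomialFun, ← Finset.prod_mul_distrib]
  simp_rw [h, Finset.prod_univ_sum]
  refine Finset.sum_congr ?_ fun _ _ => rfl
  ext β
  simp [Fintype.mem_piFinset, Pi.le_def]

variable [NeZero d]

/-- The Gram-Schmidt algorithm returns the Chebyshev polynomials: `x ^ α` minus a positive multiple
of `multiChebT α` is a combination of the `multiChebT β` with `β < α` entrywise, all of which
come before `α` in the graded lexicographic order. -/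
theorem orthoPoly_muEqProd (n : ℕ) :
    orthoPoly (muEqProd d) n = multiChebT (gradedLexEnum d n) := by
  induction n using Nat.strong_induction_on with
  | _ n ih =>
    set α := gradedLexEnum d n with hα
    obtain ⟨c, hc, h⟩ := exists_monomialFun_eq_sum α
    have hcoef : ∀ β, ∫ y, monomialFun α y * multiChebT β y ∂(muEqProd d) =
        if β ∈ Finset.Iic α then c β else 0 := by
      intro β
      simp_rw [h, Finset.sum_mul, mul_assoc]
      rw [integral_finsetSum _ fun γ _ => (integrable_multiChebT_mul γ β).const_mul _]
      simp_rw [integral_const_mul, integral_multiChebT_mul_multiChebT]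
      simp
    have hr : ∀ x, monomialFun α x - ∑ k : Fin n,
        (∫ y, monomialFun α y * orthoPoly (muEqProd d) k y ∂(muEqProd d)) *
          orthoPoly (muEqProd d) k x = c α * multiChebT α x := by
      intro x
      simp_rw [fun k : Fin n => ih k k.2, hcoef]
      rw [sum_fin_gradedLexEnum fun β => (if β ∈ Finset.Iic α then c β else 0) * multiChebT β x, h,
        sub_eq_iff_eq_add]
      simp only [ite_mul, zero_mul]
      rw [← Finset.sum_filter, ← Finset.Iio_insert, Finset.sum_insert (by simp)]
      congr 1
      refine Finset.sum_congr ?_ fun _ _ => rfl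
      ext β
      simp only [Finset.Iio_insert, Finset.mem_Iio, Finset.mem_filter, mem_initialSegment, ← hα, Finset.mem_Iic]
      constructor
      · exact fun hβ => ⟨gradedLexKey_lt_of_lt hβ, hβ.le⟩
      · rintro ⟨h1, h2⟩
        exact lt_of_le_of_ne h2 fun he => absurd h1 (by rw [he]; exact lt_irrefl _)
    rw [orthoPoly]
    funext x
    simp only [← hα]
    simp_rw [hr, mul_pow]
    rw [integral_const_mul]
    have h1 : ∫ y, multiChebT α y ^ 2 ∂(muEqProd d) = 1 := by
      simp_rw [sq]
      rw [integral_multiChebT_mul_multiChebT, if_pos rfl]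
    rw [h1, mul_one, Real.sqrt_sq hc.le]
    field_simp

theorem opEnsemble_muEqProd (N : ℕ) :
    opEnsemble (muEqProd d) N =
      projEnsemble (muEqProd d) fun n : Fin N => multiChebT (gradedLexEnum d n) := by
  unfold opEnsemble projEnsemble
  congr 1
  funext x
  congr 2
  have h := Matrix.det_mul
    (Matrix.of fun (i n : Fin N) => multiChebT (gradedLexEnum d n) (x i))
    (Matrix.of fun (i n : Fin N) => multiChebT (gradedLexEnum d n) (x i)).transpose
  rw [Matrix.det_transpose] at h
  rw [sq, ← h]
  congr 1
  ext i l
  simp [Matrix.mul_apply, cdKernel, orthoPoly_muEqProd, Finset.sum_range]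

theorem integral_multiChebT_gradedLexEnum {N : ℕ} (n m : Fin N) :
    ∫ x, multiChebT (gradedLexEnum d n) x * multiChebT (gradedLexEnum d m) x ∂(muEqProd d) =
      if n = m then 1 else 0 := by
  rw [integral_multiChebT_mul_multiChebT]
  simp [gradedLexEnum_injective.eq_iff, Fin.ext_iff]

theorem integrableAgainst_multiChebT (N : ℕ) (k l : Fin d → ℕ) :
    IntegrableAgainst (muEqProd d) (fun n : Fin N => multiChebT (gradedLexEnum d n))
      (multiChebT k) (multiChebT l) :=
  ⟨fun _ _ => integrable_multiChebT_mul _ _, fun _ _ => integrable_multiChebT_mul_mul _ _ _,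
    fun _ _ => integrable_multiChebT_mul_mul _ _ _,
    fun _ _ => integrable_multiChebT_mul_mul_mul _ _ _ _⟩

theorem isProbabilityMeasure_opEnsemble (N : ℕ) :
    IsProbabilityMeasure (opEnsemble (muEqProd d) N) := by
  rw [opEnsemble_muEqProd]
  exact isProbabilityMeasure_projEnsemble (fun n => measurable_multiChebT _)
    (integrableAgainst_multiChebT N 0 0).one integral_multiChebT_gradedLexEnum

theorem memLp_linStat_multiChebT (N : ℕ) (k : Fin d → ℕ) :
    MemLp (linStat (multiChebT k) N) 2 (opEnsemble (muEqProd d) N) := by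
  rw [opEnsemble_muEqProd]
  exact memLp_linearStatistic (fun n => measurable_multiChebT _) (measurable_multiChebT k)
    (integrableAgainst_multiChebT N k k)

/-- Only the pairs with one index inside and the other outside of the initial segment contribute to
the covariance. -/
theorem covariance_linStat_multiChebT (k l : Fin d → ℕ) {N L : ℕ}
    (hk : ∀ α ∈ initialSegment d N, ∀ j, k j + α j < L) :
    covariance (linStat (multiChebT k) N) (linStat (multiChebT l) N) (opEnsemble (muEqProd d) N) =
      ∑ α ∈ initialSegment d N, ∑ β ∈ box d L \ initialSegment d N,
        multiCoef k α β * multiCoef l α β := by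
  rw [opEnsemble_muEqProd]
  have h := covariance_linearStatistic (μ := muEqProd d)
    (u := fun n : Fin N => multiChebT (gradedLexEnum d n)) (f := multiChebT k) (g := multiChebT l)
    (fun n => measurable_multiChebT _) (measurable_multiChebT k) (measurable_multiChebT l)
    (integrableAgainst_multiChebT N k k) (integrableAgainst_multiChebT N l l)
    (integrableAgainst_multiChebT N k l) integral_multiChebT_gradedLexEnum
  refine h.trans ?_
  simp_rw [integral_multiChebT_mul_mul]
  rw [sum_fin_gradedLexEnum fun α => ∫ x, multiChebT k x * multiChebT l x *
    (multiChebT α x * multiChebT α x) ∂(muEqProd d)]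
  simp_rw [fun α => sum_fin_gradedLexEnum (N := N) fun β => multiCoef k α β * multiCoef l β α]
  rw [sum_fin_gradedLexEnum fun α => ∑ β ∈ initialSegment d N, multiCoef k α β * multiCoef l β α,
    ← Finset.sum_sub_distrib]
  refine Finset.sum_congr rfl fun α hα => ?_
  have hsub : initialSegment d N ⊆ box d L := fun β hβ =>
    mem_box.mpr fun j => (Nat.le_add_left _ _).trans_lt (hk β hβ j)
  rw [integral_multiChebT_mul_mul_mul (hk α hα), ← Finset.sum_sdiff hsub]
  simp_rw [multiCoef_comm l _ α]
  ring

end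

/-! ### Local structure of the initial segments -/

section

/-- The probability that the one-dimensional walk steps from `a` to height `T` or above. -/
theorem sum_linCoef_mul_linCoef {k l a L : ℕ} (hk : k < a) (hl : l < a) (hL : k + a < L) (T : ℕ) :
    ∑ b ∈ Finset.range L with T ≤ b, linCoef k a b * linCoef l a b =
      if k = l then 1 / 2 * ((if T ≤ a + k then 1 else 0) + (if T + k ≤ a then 1 else 0)) else 0 := by
  simp_rw [linCoef_mul_linCoef hk hl]
  by_cases hkl : k = l
  · subst hkl
    have h2 : ∀ b, (b + k = a) = (b = a - k) := fun b => propext (by omega)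
    simp only [if_true, h2]
    rw [← Finset.mul_sum, Finset.sum_add_distrib, Finset.sum_ite_eq', Finset.sum_ite_eq']
    simp only [Finset.mem_filter, Finset.mem_range]
    congr 3
    · exact propext ⟨And.right, fun h => ⟨by omega, h⟩⟩
    · exact propext ⟨fun h => by omega, fun h => by omega⟩
  · simp [hkl]

theorem sum_abs_linCoef_mul_linCoef_le (k l a : ℕ) (s : Finset ℕ) :
    ∑ b ∈ s, |linCoef k a b * linCoef l a b| ≤ 8 := by
  have hs : ∀ b ∈ s, b ∉ ({k + a, (k - a) + (a - k)} : Finset ℕ) →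
      |linCoef k a b * linCoef l a b| = 0 := by
    intro b _ hb
    simp only [Finset.mem_insert, Finset.mem_singleton, not_or] at hb
    rw [linCoef, if_neg hb.1, if_neg hb.2]
    simp
  calc ∑ b ∈ s, |linCoef k a b * linCoef l a b|
      = ∑ b ∈ s with b ∈ ({k + a, (k - a) + (a - k)} : Finset ℕ),
          |linCoef k a b * linCoef l a b| := by
        rw [Finset.sum_filter]
        refine Finset.sum_congr rfl fun b hb => ?_
        split_ifs with h
        · rfl
        · exact hs b hb h
    _ ≤ ∑ b ∈ ({k + a, (k - a) + (a - k)} : Finset ℕ), |linCoef k a b * linCoef l a b| :=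
        Finset.sum_le_sum_of_subset_of_nonneg (fun b hb => (Finset.mem_filter.mp hb).2)
          fun _ _ _ => abs_nonneg _
    _ ≤ ∑ b ∈ ({k + a, (k - a) + (a - k)} : Finset ℕ), (4 : ℝ) := by
        refine Finset.sum_le_sum fun b _ => ?_
        rw [abs_mul]
        nlinarith [abs_linCoef_le k a b, abs_linCoef_le l a b, abs_nonneg (linCoef k a b),
          abs_nonneg (linCoef l a b)]
    _ ≤ 8 := by
        rw [Finset.sum_const, nsmul_eq_mul]
        have : (({k + a, (k - a) + (a - k)} : Finset ℕ).card : ℝ) ≤ 2 := by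
          exact_mod_cast Finset.card_le_two
        linarith

variable {d : ℕ}

theorem multiCoef_eq_zero {k α β : Fin d → ℕ} {C : ℕ} (hk : ∀ j, k j ≤ C)
    (h : ¬ ∀ j, β j ≤ α j + C ∧ α j ≤ β j + C) : multiCoef k α β = 0 := by
  push Not at h
  obtain ⟨j, hj⟩ := h
  refine Finset.prod_eq_zero (Finset.mem_univ j) (linCoef_eq_zero ?_)
  have := hk j
  omega

theorem sum_abs_multiCoef_mul_multiCoef_le (k l α : Fin d → ℕ) (L : ℕ) :
    ∑ β ∈ box d L, |multiCoef k α β * multiCoef l α β| ≤ 8 ^ d := by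
  simp only [multiCoef, ← Finset.prod_mul_distrib, Finset.abs_prod]
  rw [box, ← Finset.prod_univ_sum (fun _ => Finset.range L)
    fun j b => |linCoef (k j) (α j) b * linCoef (l j) (α j) b|]
  refine (Finset.prod_le_prod (fun j _ => Finset.sum_nonneg fun _ _ => abs_nonneg _)
    fun j _ => sum_abs_linCoef_mul_linCoef_le _ _ _ _).trans ?_
  simp

/-- The sum over one half-space of the products of coefficients factorizes over the coordinates.
For `k = l` the other coordinates contribute `1`, the sum of their transition probabilities. -/
theorem sum_multiCoef_mul_multiCoef {k l α : Fin d → ℕ} {L : ℕ} (hk : ∀ i, k i < α i)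
    (hl : ∀ i, l i < α i) (hL : ∀ i, k i + α i < L) (j : Fin d) {T : ℕ} (hT : α j < T) :
    ∑ β ∈ box d L with T ≤ β j, multiCoef k α β * multiCoef l α β =
      if k = l ∧ T ≤ α j + k j then 1 / 2 else 0 := by
  have hset : {β ∈ box d L | T ≤ β j} =
      Fintype.piFinset fun i => {b ∈ Finset.range L | (if i = j then T else 0) ≤ b} := by
    ext β
    simp only [Finset.mem_filter, mem_box, Fintype.mem_piFinset, Finset.mem_range]
    constructor
    · rintro ⟨h1, h2⟩ i
      refine ⟨h1 i, ?_⟩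
      split_ifs with hi
      · rwa [hi]
      · exact Nat.zero_le _
    · intro h
      exact ⟨fun i => (h i).1, by simpa using (h j).2⟩
  rw [hset]
  simp only [multiCoef, ← Finset.prod_mul_distrib]
  rw [← Finset.prod_univ_sum (fun i => {b ∈ Finset.range L | (if i = j then T else 0) ≤ b})
    fun i b => linCoef (k i) (α i) b * linCoef (l i) (α i) b]
  simp_rw [fun i => sum_linCoef_mul_linCoef (hk i) (hl i) (hL i) (if i = j then T else 0)]
  by_cases hkl : k = l
  · subst hkl
    rw [Finset.prod_eq_single j]
    · rw [if_pos rfl, if_pos rfl, if_neg (c := T + k j ≤ α j) (by omega)]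
      by_cases h : T ≤ α j + k j <;> simp [h]
    · intro i _ hi
      rw [if_pos rfl, if_neg hi, if_pos (Nat.zero_le _), if_pos (by have := hk i; omega)]
      norm_num
    · simp
  · rw [if_neg fun h => hkl h.1]
    obtain ⟨i, hi⟩ := Function.ne_iff.mp hkl
    exact Finset.prod_eq_zero (Finset.mem_univ i) (if_neg hi)

section Shell

variable {t : Fin d → ℕ} {M : ℕ} {j : Fin d}

open Classical in
/-- The height above which the line in direction `j` through `α` leaves
`{γ | gradedLexKey γ < gradedLexKey t}`, when `t` has maximal entry `M` and the other
coordinates of `α` are smaller than `M`. -/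
def exitHeight (t : Fin d → ℕ) (M : ℕ) (j : Fin d) (α : Fin d → ℕ) : ℕ :=
  if toLex (Function.update α j M) < toLex t then M + 1 else M

theorem le_exitHeight (t : Fin d → ℕ) (M : ℕ) (j : Fin d) (α : Fin d → ℕ) :
    M ≤ exitHeight t M j α := by
  unfold exitHeight
  split_ifs <;> omega

theorem exitHeight_le (t : Fin d → ℕ) (M : ℕ) (j : Fin d) (α : Fin d → ℕ) :
    exitHeight t M j α ≤ M + 1 := by
  unfold exitHeight
  split_ifs <;> omega

theorem exitHeight_update (α : Fin d → ℕ) (x : ℕ) :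
    exitHeight t M j (Function.update α j x) = exitHeight t M j α := by
  rw [exitHeight, exitHeight, Function.update_idem]

theorem gradedLexKey_lt_iff_lt_exitHeight (ht : Finset.univ.sup t = M) {γ : Fin d → ℕ}
    (hγ : ∀ i ≠ j, γ i < M) :
    gradedLexKey γ < gradedLexKey t ↔ γ j < exitHeight t M j γ := by
  rw [gradedLexKey_lt_iff, ht]
  have hle : γ j ≤ Finset.univ.sup γ := Finset.le_sup (Finset.mem_univ j)
  rcases lt_trichotomy (γ j) M with h | h | h
  · refine iff_of_true (Or.inl ?_) (h.trans_le (le_exitHeight _ _ _ _))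
    refine (Finset.sup_lt_iff (by simpa using (Nat.zero_le _).trans_lt h)).mpr fun i _ => ?_
    by_cases hi : i = j
    · rwa [hi]
    · exact hγ i hi
  · have hs : Finset.univ.sup γ = M := by
      refine le_antisymm (Finset.sup_le fun i _ => ?_) (h ▸ hle)
      by_cases hi : i = j
      · rw [hi, h]
      · exact (hγ i hi).le
    have hu : Function.update γ j M = γ := by rw [← h, Function.update_eq_self]
    rw [exitHeight, hu, hs, h]
    by_cases hlt : toLex γ < toLex t <;> simp [hlt]
  · refine iff_of_false ?_ ?_
    · omega
    · have := exitHeight_le t M j γ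
      omega

/-- Shifting the other coordinates does not change the exit height, as long as none of them meets
or crosses the corresponding coordinate of `t`: these coordinates then decide the lexicographic
comparison with `t` in the same way before and after the shift. -/
theorem exitHeight_congr (ht : Finset.univ.sup t = M) {α β : Fin d → ℕ}
    (h : ∀ i ≠ j, α i < t i ∧ β i < t i ∨ t i < α i ∧ t i < β i) :
    exitHeight t M j α = exitHeight t M j β := by
  have htj : t j ≤ M := ht ▸ Finset.le_sup (Finset.mem_univ j)
  have key : ∀ α β : Fin d → ℕ, (∀ i ≠ j, α i < t i ∧ β i < t i ∨ t i < α i ∧ t i < β i) →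
      toLex (Function.update α j M) < toLex t → toLex (Function.update β j M) < toLex t := by
    rintro α β h ⟨i, heq, hlt⟩
    have hlt' : Function.update α j M i < t i := hlt
    -- The `j`-th coordinate `M` is not below `t j`, so it cannot be the one that decides.
    have hij : i ≠ j := by
      rintro rfl
      rw [Function.update_self] at hlt'
      omega
    refine ⟨i, fun m hm => ?_, ?_⟩
    · have hm' : Function.update α j M m = t m := heq m hm
      change Function.update β j M m = t m
      by_cases hmj : m = j
      · subst hmj
        rwa [Function.update_self] at hm' ⊢
      · rw [Function.update_of_ne hmj] at hm'
        have := h m hmj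
        omega
    · change Function.update β j M i < t i
      rw [Function.update_of_ne hij] at hlt' ⊢
      have := h i hij
      omega
  unfold exitHeight
  congr 1
  exact propext ⟨key α β h, key β α fun i hi => by have := h i hi; omega⟩

end Shell

end

/-! ### Counting boundary points -/

section

variable {d : ℕ}

/-- The coordinates that lie within `C` of the bottom `0`, of the top `M`, or of `τ`. -/
def IsSpecial (C M τ a : ℕ) : Prop := a ≤ C ∨ M ≤ a + C ∨ (a ≤ τ + C ∧ τ ≤ a + C)

instance (C M τ : ℕ) : DecidablePred (IsSpecial C M τ) := fun _ => by
  unfold IsSpecial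
  infer_instance

theorem card_isSpecial_le (C M τ : ℕ) :
    {a ∈ Finset.range (M + 1) | IsSpecial C M τ a}.card ≤ 4 * C + 3 := by
  have hsub : {a ∈ Finset.range (M + 1) | IsSpecial C M τ a} ⊆
      (Finset.range (C + 1) ∪ Finset.Icc (M - C) M) ∪ Finset.Icc (τ - C) (τ + C) := by
    intro a ha
    obtain ⟨h1, h2⟩ := Finset.mem_filter.mp ha
    rw [Finset.mem_range] at h1
    rw [Finset.mem_union, Finset.mem_union, Finset.mem_range, Finset.mem_Icc, Finset.mem_Icc]
    unfold IsSpecial at h2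
    omega
  refine (Finset.card_le_card hsub).trans ((Finset.card_union_le _ _).trans ?_)
  have h1 := Finset.card_union_le (Finset.range (C + 1)) (Finset.Icc (M - C) M)
  rw [Finset.card_range, Nat.card_Icc] at h1
  rw [Nat.card_Icc]
  omega

/-- The number of coordinates in `[0, M]` that are not special. -/
def numRegular (C M τ : ℕ) : ℕ := {a ∈ Finset.range (M + 1) | ¬ IsSpecial C M τ a}.card

theorem numRegular_le (C M τ : ℕ) : numRegular C M τ ≤ M + 1 :=
  (Finset.card_filter_le _ _).trans (Finset.card_range _).le

theorem le_numRegular (C M τ : ℕ) : M + 1 ≤ numRegular C M τ + (4 * C + 3) := by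
  have h : {a ∈ Finset.range (M + 1) | IsSpecial C M τ a}.card + numRegular C M τ =
    (Finset.range (M + 1)).card := Finset.card_filter_add_card_filter_not _
  rw [Finset.card_range] at h
  have := card_isSpecial_le C M τ
  omega

open Classical in
/-- The multi-indices of `[0, M]^d` with at least two special coordinates. -/
def exceptionalSet (C M : ℕ) (t : Fin d → ℕ) : Finset (Fin d → ℕ) :=
  {α ∈ box d (M + 1) | ∃ i j, i ≠ j ∧ IsSpecial C M (t i) (α i) ∧ IsSpecial C M (t j) (α j)}

/-- Two special coordinates save a factor `(M + 1) ^ 2`. It stands on the left-hand side since the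
exponent `d - 2` would be truncated for `d = 1`. -/
theorem card_special_pair_mul_le (C M : ℕ) (t : Fin d → ℕ) {i j : Fin d} (hij : i ≠ j) :
    (Fintype.piFinset fun m => {a ∈ Finset.range (M + 1) |
      m = i ∨ m = j → IsSpecial C M (t m) a}).card * (M + 1) ^ 2 ≤
      (4 * C + 3) ^ 2 * (M + 1) ^ d := by
  rw [Fintype.card_piFinset]
  have h1 : ∏ m, {a ∈ Finset.range (M + 1) | m = i ∨ m = j → IsSpecial C M (t m) a}.card ≤
      ∏ m : Fin d, if m ∈ ({i, j} : Finset (Fin d)) then 4 * C + 3 else M + 1 := by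
    refine Finset.prod_le_prod' fun m _ => ?_
    split_ifs with hm
    · have hm' : m = i ∨ m = j := by simpa using hm
      simp only [hm', forall_const]
      exact card_isSpecial_le C M (t m)
    · exact (Finset.card_filter_le _ _).trans (Finset.card_range _).le
  refine (Nat.mul_le_mul_right _ h1).trans ?_
  have hc : ({m | m ∈ ({i, j} : Finset (Fin d))} : Finset (Fin d)).card = 2 := by
    rw [Finset.filter_mem_eq_inter, Finset.univ_inter, Finset.card_pair hij]
  have hc' := Finset.card_filter_add_card_filter_not (s := Finset.univ)
    (fun m => m ∈ ({i, j} : Finset (Fin d)))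
  rw [hc, Finset.card_univ, Fintype.card_fin] at hc'
  rw [Finset.prod_ite, Finset.prod_const, Finset.prod_const, hc, mul_assoc, ← pow_add]
  refine le_of_eq ?_
  congr 2
  omega

theorem card_exceptionalSet_mul_le (C M : ℕ) (t : Fin d → ℕ) :
    (exceptionalSet C M t).card * (M + 1) ^ 2 ≤ d ^ 2 * ((4 * C + 3) ^ 2 * (M + 1) ^ d) := by
  set P : Fin d × Fin d → Finset (Fin d → ℕ) := fun p => Fintype.piFinset fun m =>
    {a ∈ Finset.range (M + 1) | m = p.1 ∨ m = p.2 → IsSpecial C M (t m) a} with hP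
  have hsub : exceptionalSet C M t ⊆ (Finset.univ.filter fun p : Fin d × Fin d => p.1 ≠ p.2).biUnion
      P := by
    intro α hα
    rw [exceptionalSet, Finset.mem_filter, mem_box] at hα
    obtain ⟨h1, i, j, hij, hi, hj⟩ := hα
    rw [Finset.mem_biUnion]
    refine ⟨(i, j), by simpa using hij, ?_⟩
    simp only [hP, Fintype.mem_piFinset, Finset.mem_filter, Finset.mem_range]
    refine fun m => ⟨h1 m, ?_⟩
    rintro (rfl | rfl)
    · exact hi
    · exact hj
  calc (exceptionalSet C M t).card * (M + 1) ^ 2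
      ≤ (∑ p : Fin d × Fin d with p.1 ≠ p.2, (P p).card) * (M + 1) ^ 2 :=
        Nat.mul_le_mul_right _ ((Finset.card_le_card hsub).trans Finset.card_biUnion_le)
    _ = ∑ p : Fin d × Fin d with p.1 ≠ p.2, (P p).card * (M + 1) ^ 2 := Finset.sum_mul _ _ _
    _ ≤ ∑ p : Fin d × Fin d with p.1 ≠ p.2, (4 * C + 3) ^ 2 * (M + 1) ^ d :=
        Finset.sum_le_sum fun p hp =>
          card_special_pair_mul_le C M t (Finset.mem_filter.mp hp).2
    _ ≤ d ^ 2 * ((4 * C + 3) ^ 2 * (M + 1) ^ d) := by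
        rw [Finset.sum_const, smul_eq_mul]
        refine Nat.mul_le_mul_right _ ((Finset.card_filter_le _ _).trans ?_)
        simp [sq]

open Classical in
/-- The multi-indices of the face orthogonal to direction `j`: those that the shift by `κ` in
direction `j` moves above the exit height, and whose other coordinates are not special. -/
def face (C M : ℕ) (t : Fin d → ℕ) (κ : ℕ) (j : Fin d) : Finset (Fin d → ℕ) :=
  {α ∈ box d (M + 1) | (∀ i ≠ j, ¬ IsSpecial C M (t i) (α i)) ∧
    α j < exitHeight t M j α ∧ exitHeight t M j α ≤ α j + κ}

/-- Lowering the lines whose exit height is `M + 1` by one step makes the face a product set. -/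
theorem card_face {C M : ℕ} (t : Fin d → ℕ) {κ : ℕ} (hκ : κ ≤ M) (j : Fin d) :
    (face C M t κ j).card = κ * ∏ i ∈ Finset.univ.erase j, numRegular C M (t i) := by
  have hcard : (Fintype.piFinset fun i => if i = j then Finset.Ico (M - κ) M else
      {a ∈ Finset.range (M + 1) | ¬ IsSpecial C M (t i) a}).card =
      κ * ∏ i ∈ Finset.univ.erase j, numRegular C M (t i) := by
    rw [Fintype.card_piFinset, ← Finset.mul_prod_erase _ _ (Finset.mem_univ j)]
    congr 1
    · rw [if_pos rfl, Nat.card_Ico]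
      omega
    · refine Finset.prod_congr rfl fun i hi => ?_
      rw [if_neg (Finset.ne_of_mem_erase hi), numRegular]
  rw [← hcard]
  refine Finset.card_nbij' (fun α => Function.update α j (α j - (exitHeight t M j α - M)))
    (fun α => Function.update α j (α j + (exitHeight t M j α - M))) ?_ ?_ ?_ ?_
  · intro α hα
    rw [face, Finset.mem_coe, Finset.mem_filter, mem_box] at hα
    obtain ⟨h1, h2, h3, h4⟩ := hα
    have := le_exitHeight t M j α
    rw [Finset.mem_coe, Fintype.mem_piFinset]
    beta_reduce
    intro i
    by_cases hi : i = j
    · subst hi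
      rw [if_pos rfl, Function.update_self, Finset.mem_Ico]
      omega
    · rw [if_neg hi, Function.update_of_ne hi, Finset.mem_filter, Finset.mem_range]
      exact ⟨h1 i, h2 i hi⟩
  · intro α hα
    rw [Finset.mem_coe, Fintype.mem_piFinset] at hα
    have := le_exitHeight t M j α
    have := exitHeight_le t M j α
    have hj := hα j
    rw [if_pos rfl, Finset.mem_Ico] at hj
    have h : ∀ i ≠ j, α i < M + 1 ∧ ¬ IsSpecial C M (t i) (α i) := fun i hi => by
      have := hα i
      rwa [if_neg hi, Finset.mem_filter, Finset.mem_range] at this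
    beta_reduce
    rw [face, Finset.mem_coe, Finset.mem_filter, mem_box, exitHeight_update,
      Function.update_self]
    refine ⟨fun i => ?_, fun i hi => ?_, by omega, by omega⟩
    · by_cases hi : i = j
      · subst hi
        rw [Function.update_self]
        omega
      · rw [Function.update_of_ne hi]
        exact (h i hi).1
    · rw [Function.update_of_ne hi]
      exact (h i hi).2
  · intro α hα
    rw [face, Finset.mem_coe, Finset.mem_filter] at hα
    obtain ⟨-, -, h3, h4⟩ := hα
    have := le_exitHeight t M j α
    have := exitHeight_le t M j α
    beta_reduce
    rw [exitHeight_update, Function.update_self, Function.update_idem]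
    have : α j - (exitHeight t M j α - M) + (exitHeight t M j α - M) = α j := by omega
    rw [this, Function.update_eq_self]
  · intro α _
    beta_reduce
    rw [exitHeight_update, Function.update_self, Function.update_idem, Nat.add_sub_cancel,
      Function.update_eq_self]

end

/-! ### The covariance and its limit -/

section

variable {d : ℕ} [NeZero d] {k l : Fin d → ℕ} {C M N L : ℕ}

theorem le_of_mem_initialSegment (hM : Finset.univ.sup (gradedLexEnum d N) = M) {α : Fin d → ℕ}
    (hα : α ∈ initialSegment d N) (j : Fin d) : α j ≤ M := by
  rw [mem_initialSegment, gradedLexKey_lt_iff, hM] at hα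
  have hj : α j ≤ Finset.univ.sup α := Finset.le_sup (Finset.mem_univ j)
  omega

theorem mem_initialSegment_of_lt (hM : Finset.univ.sup (gradedLexEnum d N) = M) {α : Fin d → ℕ}
    (hα : ∀ j, α j < M) : α ∈ initialSegment d N := by
  rw [mem_initialSegment, gradedLexKey_lt_iff, hM]
  exact Or.inl ((Finset.sup_lt_iff (by simpa using (Nat.zero_le _).trans_lt (hα 0))).mpr
    fun j _ => hα j)

/-- If all coordinates of `α` but the `j`-th are regular, and the `j`-th one is close to the top,
then among the neighbours `β` of `α` those outside of the initial segment form a half-space. -/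
theorem sum_outside_of_regular (hk : ∀ j, k j ≤ C) (hl : ∀ j, l j ≤ C)
    (hM : Finset.univ.sup (gradedLexEnum d N) = M) (hCM : 2 * C < M) (hL : M + C < L)
    {α : Fin d → ℕ} (hα : α ∈ initialSegment d N) {j : Fin d}
    (hj : ∀ i ≠ j, ¬ IsSpecial C M (gradedLexEnum d N i) (α i)) (htop : M ≤ α j + C) :
    ∑ β ∈ box d L \ initialSegment d N, multiCoef k α β * multiCoef l α β =
      if k = l ∧ exitHeight (gradedLexEnum d N) M j α ≤ α j + k j then 1 / 2 else 0 := by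
  set t := gradedLexEnum d N with ht
  have hle := le_of_mem_initialSegment hM hα
  have hbulk : ∀ i, C < α i := by
    intro i
    by_cases hi : i = j
    · subst hi; omega
    · have := hj i hi
      unfold IsSpecial at this
      omega
  have hmem : ∀ β : Fin d → ℕ, (∀ i, β i ≤ α i + C ∧ α i ≤ β i + C) →
      (β ∈ initialSegment d N ↔ β j < exitHeight t M j α) := by
    intro β hβ
    have h1 : ∀ i ≠ j, β i < M := fun i hi => by
      have := hj i hi
      have := hβ i
      unfold IsSpecial at *
      omega
    rw [mem_initialSegment, ← ht, gradedLexKey_lt_iff_lt_exitHeight hM h1,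
      exitHeight_congr hM (α := α) (β := β)]
    intro i hi
    have := hj i hi
    have := hβ i
    unfold IsSpecial at *
    omega
  rw [← sum_multiCoef_mul_multiCoef (L := L) (fun i => (hk i).trans_lt (hbulk i))
    (fun i => (hl i).trans_lt (hbulk i)) (fun i => by have := hk i; have := hle i; omega) j
    ((hmem α fun i => by omega).mp hα), ← Finset.filter_notMem_eq_sdiff, Finset.sum_filter,
    Finset.sum_filter]
  refine Finset.sum_congr rfl fun β _ => ?_
  by_cases hβ : ∀ i, β i ≤ α i + C ∧ α i ≤ β i + C
  · have := hmem β hβ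
    by_cases hT : exitHeight t M j α ≤ β j
    · rw [if_pos hT, if_pos (by rw [this]; omega)]
    · rw [if_neg hT, if_neg (by rw [this]; omega)]
  · rw [multiCoef_eq_zero hk hβ, zero_mul]
    simp

theorem sum_outside_of_lt (hk : ∀ j, k j ≤ C)
    (hM : Finset.univ.sup (gradedLexEnum d N) = M) {α : Fin d → ℕ} (hα : ∀ j, α j + C < M) :
    ∑ β ∈ box d L \ initialSegment d N, multiCoef k α β * multiCoef l α β = 0 := by
  refine Finset.sum_eq_zero fun β hβ => ?_
  rw [multiCoef_eq_zero hk, zero_mul]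
  intro h
  exact (Finset.mem_sdiff.mp hβ).2
    (mem_initialSegment_of_lt hM fun j => (h j).1.trans_lt (hα j))

theorem face_subset_initialSegment (hM : Finset.univ.sup (gradedLexEnum d N) = M) (κ : ℕ)
    (j : Fin d) : face C M (gradedLexEnum d N) κ j ⊆ initialSegment d N := by
  intro α hα
  rw [face, Finset.mem_filter, mem_box] at hα
  obtain ⟨h1, h2, h3, -⟩ := hα
  rw [mem_initialSegment, gradedLexKey_lt_iff_lt_exitHeight hM (j := j)]
  · exact h3
  · intro i hi
    have := h2 i hi
    unfold IsSpecial at this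
    omega

omit [NeZero d] in
theorem le_add_of_mem_face {t : Fin d → ℕ} {κ : ℕ} (hκ : κ ≤ C) {j : Fin d} {α : Fin d → ℕ}
    (hα : α ∈ face C M t κ j) : M ≤ α j + C := by
  rw [face, Finset.mem_filter] at hα
  have := le_exitHeight t M j α
  omega

/-- Up to the exceptional set, a point of the initial segment contributes to the covariance if and
only if it lies on one of the faces. -/
theorem sum_outside_eq (hk : ∀ j, k j ≤ C) (hl : ∀ j, l j ≤ C)
    (hM : Finset.univ.sup (gradedLexEnum d N) = M) (hCM : 2 * C < M) (hL : M + C < L)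
    {α : Fin d → ℕ} (hα : α ∈ initialSegment d N)
    (hexc : α ∉ exceptionalSet C M (gradedLexEnum d N)) :
    ∑ β ∈ box d L \ initialSegment d N, multiCoef k α β * multiCoef l α β =
      if k = l then
        ∑ j, if α ∈ face C M (gradedLexEnum d N) (k j) j then (1 / 2 : ℝ) else 0 else 0 := by
  have hle := le_of_mem_initialSegment hM hα
  by_cases htop : ∀ j, α j + C < M
  · rw [sum_outside_of_lt hk hM htop]
    split_ifs
    · symm
      refine Finset.sum_eq_zero fun j _ => if_neg fun h => ?_
      have := le_add_of_mem_face (hk j) h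
      have := htop j
      omega
    · rfl
  · push Not at htop
    obtain ⟨j, hj⟩ := htop
    have hspec : IsSpecial C M (gradedLexEnum d N j) (α j) := Or.inr (Or.inl hj)
    have hreg : ∀ i ≠ j, ¬ IsSpecial C M (gradedLexEnum d N i) (α i) := by
      intro i hi hs
      refine hexc ?_
      rw [exceptionalSet, Finset.mem_filter, mem_box]
      exact ⟨fun m => Nat.lt_succ_of_le (hle m), i, j, hi, hs, hspec⟩
    rw [sum_outside_of_regular hk hl hM hCM hL hα hreg hj]
    by_cases hkl : k = l
    · rw [if_pos hkl, Finset.sum_eq_single j]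
      · refine if_congr ?_ rfl rfl
        rw [face, Finset.mem_filter, mem_box]
        have h3 : α j < exitHeight (gradedLexEnum d N) M j α := by
          rw [← gradedLexKey_lt_iff_lt_exitHeight hM, ← mem_initialSegment]
          · exact hα
          · intro i hi
            have := hreg i hi
            unfold IsSpecial at this
            omega
        exact ⟨fun h => ⟨fun m => Nat.lt_succ_of_le (hle m), hreg, h3, h.2⟩,
          fun h => ⟨hkl, h.2.2.2⟩⟩
      · intro i _ hij
        refine if_neg fun h => ?_
        rw [face, Finset.mem_filter] at h
        exact h.2.1 j (Ne.symm hij) hspec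
      · simp
    · rw [if_neg hkl, if_neg fun h => hkl h.1]

/-- The covariance is half the number of points on the faces, up to the contribution of the
exceptional set. -/
theorem abs_covariance_sub_le (hk : ∀ j, k j ≤ C) (hl : ∀ j, l j ≤ C)
    (hM : Finset.univ.sup (gradedLexEnum d N) = M) (hCM : 2 * C < M) :
    |covariance (linStat (multiChebT k) N) (linStat (multiChebT l) N) (opEnsemble (muEqProd d) N) -
      (if k = l then ∑ j, 1 / 2 * ((k j : ℝ) *
        ∏ i ∈ Finset.univ.erase j, (numRegular C M (gradedLexEnum d N i) : ℝ)) else 0)| ≤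
      8 ^ d * (exceptionalSet C M (gradedLexEnum d N)).card := by
  set t := gradedLexEnum d N with ht
  set L := M + C + 1 with hL
  have hcov := covariance_linStat_multiChebT k l (N := N) (L := L) fun α hα j => by
    have := le_of_mem_initialSegment hM hα j
    have := hk j
    omega
  rw [hcov]
  have hmain : (if k = l then ∑ j, 1 / 2 * ((k j : ℝ) *
        ∏ i ∈ Finset.univ.erase j, (numRegular C M (t i) : ℝ)) else 0) =
      ∑ α ∈ initialSegment d N, if k = l then
        ∑ j, if α ∈ face C M t (k j) j then (1 / 2 : ℝ) else 0 else 0 := by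
    by_cases hkl : k = l
    · simp only [hkl, if_true]
      rw [Finset.sum_comm]
      refine Finset.sum_congr rfl fun j _ => ?_
      have hκ : l j ≤ M := by have := hl j; omega
      rw [← Finset.sum_filter, Finset.filter_mem_eq_inter,
        Finset.inter_eq_right.mpr (face_subset_initialSegment hM _ _), Finset.sum_const,
        card_face t hκ, nsmul_eq_mul]
      push_cast
      ring
    · simp [hkl]
  rw [hmain, ← Finset.sum_sub_distrib]
  have hterm : ∀ α ∈ initialSegment d N,
      |(∑ β ∈ box d L \ initialSegment d N, multiCoef k α β * multiCoef l α β) -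
        (if k = l then ∑ j, if α ∈ face C M t (k j) j then (1 / 2 : ℝ) else 0 else 0)| ≤
      if α ∈ exceptionalSet C M t then 8 ^ d else 0 := by
    intro α hα
    by_cases hexc : α ∈ exceptionalSet C M t
    · have hz : (if k = l then ∑ j, if α ∈ face C M t (k j) j then (1 / 2 : ℝ) else 0 else 0) =
          0 := by
        split_ifs
        · refine Finset.sum_eq_zero fun j _ => if_neg fun h => ?_
          rw [face, Finset.mem_filter] at h
          rw [exceptionalSet, Finset.mem_filter] at hexc
          obtain ⟨-, i, i', hii, hi, hi'⟩ := hexc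
          by_cases hij : i = j
          · exact h.2.1 i' (fun h' => hii (hij.trans h'.symm)) hi'
          · exact h.2.1 i hij hi
        · rfl
      rw [if_pos hexc, hz, sub_zero]
      exact (Finset.abs_sum_le_sum_abs _ _).trans
        ((Finset.sum_le_sum_of_subset_of_nonneg Finset.sdiff_subset
          fun _ _ _ => abs_nonneg _).trans (sum_abs_multiCoef_mul_multiCoef_le k l α L))
    · rw [sum_outside_eq hk hl hM hCM (by omega) hα hexc, sub_self, abs_zero, if_neg hexc]
  refine (Finset.abs_sum_le_sum_abs _ _).trans ((Finset.sum_le_sum hterm).trans ?_)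
  rw [← Finset.sum_filter, Finset.sum_const, nsmul_eq_mul, mul_comm, Finset.filter_mem_eq_inter]
  refine mul_le_mul_of_nonneg_left ?_ (by positivity)
  exact_mod_cast Finset.card_le_card Finset.inter_subset_right

omit [NeZero d] in
theorem card_box (L : ℕ) : (box d L).card = L ^ d := by
  simp [box, Fintype.card_piFinset]

variable (d) in
/-- The maximal entry of the first multi-index outside of the initial segment. -/
def shellIndex (N : ℕ) : ℕ := Finset.univ.sup (gradedLexEnum d N)

theorem shellIndex_pow_le (N : ℕ) : shellIndex d N ^ d ≤ N := by
  rw [← card_box (d := d)]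
  refine (Finset.card_le_card fun α hα => ?_).trans (card_initialSegment (d := d) N).le
  exact mem_initialSegment_of_lt rfl (mem_box.mp hα)

theorem le_shellIndex_succ_pow (N : ℕ) : N ≤ (shellIndex d N + 1) ^ d := by
  rw [← card_box (d := d)]
  refine (card_initialSegment (d := d) N).ge.trans (Finset.card_le_card fun α hα => ?_)
  exact mem_box.mpr fun j => Nat.lt_succ_of_le (le_of_mem_initialSegment rfl hα j)

variable (d) in
/-- The scale `N ^ (1 / d)` of the initial segment. -/
def scale (N : ℕ) : ℝ := (N : ℝ) ^ (1 / (d : ℝ))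

omit [NeZero d] in
theorem scale_nonneg (N : ℕ) : 0 ≤ scale d N := Real.rpow_nonneg (Nat.cast_nonneg N) _

theorem scale_pow (N : ℕ) : scale d N ^ d = N := by
  rw [scale, one_div, Real.rpow_inv_natCast_pow (Nat.cast_nonneg N) (NeZero.ne d)]

theorem shellIndex_le_scale (N : ℕ) : (shellIndex d N : ℝ) ≤ scale d N := by
  refine le_of_pow_le_pow_left₀ (NeZero.ne d) (scale_nonneg N) ?_
  rw [scale_pow]
  exact_mod_cast shellIndex_pow_le N

theorem scale_le_shellIndex_succ (N : ℕ) : scale d N ≤ shellIndex d N + 1 := by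
  refine le_of_pow_le_pow_left₀ (NeZero.ne d) (by positivity) ?_
  rw [scale_pow]
  exact_mod_cast le_shellIndex_succ_pow N

theorem rpow_one_sub_eq_scale_pow (N : ℕ) :
    (N : ℝ) ^ (1 - 1 / (d : ℝ)) = scale d N ^ (d - 1) := by
  have hd : (d : ℝ) ≠ 0 := Nat.cast_ne_zero.mpr (NeZero.ne d)
  rw [scale, ← Real.rpow_natCast, ← Real.rpow_mul (Nat.cast_nonneg N),
    Nat.cast_sub (NeZero.one_le)]
  congr 1
  field_simp
  simp

theorem tendsto_scale : Tendsto (scale d) atTop atTop :=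
  (tendsto_rpow_atTop (one_div_pos.mpr (Nat.cast_pos.mpr (NeZero.pos d)))).comp
    tendsto_natCast_atTop_atTop

theorem tendsto_shellIndex : Tendsto (shellIndex d) atTop atTop := by
  rw [← tendsto_natCast_atTop_iff (R := ℝ)]
  refine tendsto_atTop_mono (fun N => ?_) (tendsto_atTop_add_const_right _ (-1)
    (tendsto_scale (d := d)))
  linarith [scale_le_shellIndex_succ (d := d) N]

/-- A quantity within bounded distance of the scale is asymptotic to it. -/
theorem tendsto_div_scale {f : ℕ → ℝ} (B : ℝ) (h : ∀ N, |f N - scale d N| ≤ B) :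
    Tendsto (fun N => f N / scale d N) atTop (𝓝 1) := by
  have h0 : Tendsto (fun N => (f N - scale d N) / scale d N) atTop (𝓝 0) := by
    refine squeeze_zero_norm (fun N => ?_) (tendsto_const_nhds.div_atTop (tendsto_scale (d := d)) (a := B))
    rw [Real.norm_eq_abs, abs_div, abs_of_nonneg (scale_nonneg N)]
    exact div_le_div_of_nonneg_right (h N) (scale_nonneg N)
  have h1 := h0.add_const 1
  rw [zero_add] at h1
  refine h1.congr' ?_
  filter_upwards [(tendsto_scale (d := d)).eventually_gt_atTop 0] with N hN
  field_simp
  ring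

/-- The number of points on the faces, on the scale `N ^ (1 - 1 / d)`. -/
theorem tendsto_main_term (C : ℕ) (k : Fin d → ℕ) :
    Tendsto (fun N => (∑ j, 1 / 2 * ((k j : ℝ) * ∏ i ∈ Finset.univ.erase j,
      (numRegular C (shellIndex d N) (gradedLexEnum d N i) : ℝ))) / scale d N ^ (d - 1))
      atTop (𝓝 (1 / 2 * ∑ j, (k j : ℝ))) := by
  have hreg : ∀ i, Tendsto (fun N => (numRegular C (shellIndex d N) (gradedLexEnum d N i) : ℝ) /
      scale d N) atTop (𝓝 1) := by
    intro i
    refine tendsto_div_scale (4 * C + 3) fun N => ?_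
    have h1 : (numRegular C (shellIndex d N) (gradedLexEnum d N i) : ℝ) ≤ shellIndex d N + 1 := by
      exact_mod_cast numRegular_le C (shellIndex d N) (gradedLexEnum d N i)
    have h2 : (shellIndex d N : ℝ) + 1 ≤
        numRegular C (shellIndex d N) (gradedLexEnum d N i) + (4 * C + 3) := by
      exact_mod_cast le_numRegular C (shellIndex d N) (gradedLexEnum d N i)
    have h3 := shellIndex_le_scale (d := d) N
    have h4 := scale_le_shellIndex_succ (d := d) N
    have h5 : (0 : ℝ) ≤ C := Nat.cast_nonneg C
    rw [abs_le]
    constructor <;> linarith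
  have hsum : Tendsto (fun N => ∑ j, 1 / 2 * ((k j : ℝ) * ∏ i ∈ Finset.univ.erase j,
      ((numRegular C (shellIndex d N) (gradedLexEnum d N i) : ℝ) / scale d N)))
      atTop (𝓝 (∑ j, 1 / 2 * ((k j : ℝ) * ∏ i ∈ Finset.univ.erase j, (1 : ℝ)))) :=
    tendsto_finsetSum _ fun j _ => 
      ((tendsto_finsetProd _ fun i _ => hreg i).const_mul _).const_mul _
  simp only [Finset.prod_const_one, mul_one, ← Finset.mul_sum] at hsum
  refine hsum.congr fun N => ?_
  rw [← Finset.mul_sum, mul_div_assoc, Finset.sum_div]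
  congr 1
  refine Finset.sum_congr rfl fun j _ => ?_
  rw [Finset.prod_div_distrib, Finset.prod_const, Finset.card_erase_of_mem (Finset.mem_univ j),
    Finset.card_univ, Fintype.card_fin, mul_div_assoc]

/-- The exceptional set has codimension two, hence is negligible on the scale `N ^ (1 - 1 / d)`. -/
theorem tendsto_card_exceptionalSet (C : ℕ) :
    Tendsto (fun N => (8 ^ d * ((exceptionalSet C (shellIndex d N) (gradedLexEnum d N)).card : ℝ)) /
      scale d N ^ (d - 1)) atTop (𝓝 0) := by
  have hM : Tendsto (fun N => ((shellIndex d N : ℝ) + 1) / scale d N) atTop (𝓝 1) := by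
    refine tendsto_div_scale 1 fun N => ?_
    have h3 := shellIndex_le_scale (d := d) N
    have h4 := scale_le_shellIndex_succ (d := d) N
    rw [abs_le]
    constructor <;> linarith
  have hlim : Tendsto (fun N => 8 ^ d * (d ^ 2 * (4 * (C : ℝ) + 3) ^ 2) *
      ((((shellIndex d N : ℝ) + 1) / scale d N) ^ d * (scale d N)⁻¹)) atTop (𝓝 0) := by
    have := ((hM.pow d).mul (tendsto_inv_atTop_zero.comp (tendsto_scale (d := d)))).const_mul
      (8 ^ d * (d ^ 2 * (4 * (C : ℝ) + 3) ^ 2))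
    simpa using this
  refine squeeze_zero' (Eventually.of_forall fun N => ?_) ?_ hlim
  · have := scale_nonneg (d := d) N
    positivity
  · filter_upwards [(tendsto_scale (d := d)).eventually_gt_atTop 0] with N hN
    set r := scale d N
    set m : ℝ := (shellIndex d N : ℝ) + 1 with hm
    set c : ℝ := ((exceptionalSet C (shellIndex d N) (gradedLexEnum d N)).card : ℝ)
    have hrm : r ≤ m := scale_le_shellIndex_succ N
    have hc : c * m ^ 2 ≤ d ^ 2 * ((4 * C + 3) ^ 2 * m ^ d) := by
      have h := (Nat.cast_le (α := ℝ)).mpr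
        (card_exceptionalSet_mul_le C (shellIndex d N) (gradedLexEnum d N))
      push_cast at h
      exact h
    have hc0 : 0 ≤ c := Nat.cast_nonneg _
    -- Weakening `m ^ 2` to `r ^ 2` leaves the bound `(m / r) ^ d / r`, up to a constant.
    have hcr : c * r ^ 2 ≤ d ^ 2 * ((4 * C + 3) ^ 2 * m ^ d) :=
      (mul_le_mul_of_nonneg_left (pow_le_pow_left₀ hN.le hrm 2) hc0).trans hc
    have hpow : r ^ d = r ^ (d - 1) * r := by
      rw [← pow_succ, Nat.sub_add_cancel NeZero.one_le]
    have hrhs : 8 ^ d * (d ^ 2 * (4 * (C : ℝ) + 3) ^ 2) * ((m / r) ^ d * r⁻¹) =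
        8 ^ d * (d ^ 2 * ((4 * C + 3) ^ 2 * m ^ d)) / (r ^ (d - 1) * r ^ 2) := by
      rw [div_pow, hpow]
      field_simp
    rw [hrhs, div_le_div_iff₀ (by positivity) (by positivity)]
    calc 8 ^ d * c * (r ^ (d - 1) * r ^ 2) = 8 ^ d * (c * r ^ 2) * r ^ (d - 1) := by ring
      _ ≤ _ := by gcongr

end

end OPEnsemble

end

theorem mainTheorem7 (d : ℕ) [NeZero d] (k l : Fin d → ℕ) :
    (∀ N : ℕ, IsProbabilityMeasure (OPEnsemble.opEnsemble (OPEnsemble.muEqProd d) N) ∧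
      MemLp (OPEnsemble.linStat (OPEnsemble.multiChebT k) N) 2
        (OPEnsemble.opEnsemble (OPEnsemble.muEqProd d) N) ∧
      MemLp (OPEnsemble.linStat (OPEnsemble.multiChebT l) N) 2
        (OPEnsemble.opEnsemble (OPEnsemble.muEqProd d) N)) ∧
    Tendsto
      (fun N : ℕ =>
        1 / (N : ℝ) ^ (1 - 1 / (d : ℝ)) *
          covariance (OPEnsemble.linStat (OPEnsemble.multiChebT k) N)
            (OPEnsemble.linStat (OPEnsemble.multiChebT l) N)
            (OPEnsemble.opEnsemble (OPEnsemble.muEqProd d) N))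
      atTop (𝓝 (if k = l then 1 / 2 * ∑ j, (k j : ℝ) else 0)) := by
  refine ⟨fun N => ⟨OPEnsemble.isProbabilityMeasure_opEnsemble N,
    OPEnsemble.memLp_linStat_multiChebT N k, OPEnsemble.memLp_linStat_multiChebT N l⟩, ?_⟩
  obtain ⟨C, hk, hl⟩ : ∃ C, (∀ j, k j ≤ C) ∧ ∀ j, l j ≤ C :=
    ⟨Finset.univ.sup (k ⊔ l), fun j => le_sup_left.trans (Finset.le_sup (f := k ⊔ l)
      (Finset.mem_univ j)), fun j => le_sup_right.trans (Finset.le_sup (f := k ⊔ l)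
      (Finset.mem_univ j))⟩
  have hmain : Tendsto (fun N => (if k = l then ∑ j, 1 / 2 * ((k j : ℝ) *
      ∏ i ∈ Finset.univ.erase j, (OPEnsemble.numRegular C (OPEnsemble.shellIndex d N)
        (OPEnsemble.gradedLexEnum d N i) : ℝ)) else 0) / OPEnsemble.scale d N ^ (d - 1))
      atTop (𝓝 (if k = l then 1 / 2 * ∑ j, (k j : ℝ) else 0)) := by
    split_ifs
    · exact OPEnsemble.tendsto_main_term C k
    · simp
  have herr := squeeze_zero_norm' (f := fun N : ℕ =>
    (covariance (OPEnsemble.linStat (OPEnsemble.multiChebT k) N)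
      (OPEnsemble.linStat (OPEnsemble.multiChebT l) N)
      (OPEnsemble.opEnsemble (OPEnsemble.muEqProd d) N) -
    (if k = l then ∑ j, 1 / 2 * ((k j : ℝ) *
      ∏ i ∈ Finset.univ.erase j, (OPEnsemble.numRegular C (OPEnsemble.shellIndex d N)
        (OPEnsemble.gradedLexEnum d N i) : ℝ)) else 0)) / OPEnsemble.scale d N ^ (d - 1)) ?_
    (OPEnsemble.tendsto_card_exceptionalSet (d := d) C)
  · have := herr.add hmain
    rw [zero_add] at this
    refine this.congr fun N => ?_
    rw [OPEnsemble.rpow_one_sub_eq_scale_pow]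
    ring
  · filter_upwards [(OPEnsemble.tendsto_shellIndex (d := d)).eventually_gt_atTop (2 * C)] with N hN
    rw [norm_div, Real.norm_eq_abs, Real.norm_of_nonneg
      (pow_nonneg (OPEnsemble.scale_nonneg N) _)]
    exact div_le_div_of_nonneg_right (OPEnsemble.abs_covariance_sub_le hk hl rfl hN)
      (pow_nonneg (OPEnsemble.scale_nonneg N) _)
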